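/- Let $n\ge 4$. Operators on $(\mathbb C^2)^{\otimes n}$ are called $n$-qubit operators. The Schmidt rank of an $n$-qubit operator $U$ is the least $r$ such that $U=\sum_{j=1}^r A_{j,1}\otimes\cdots\otimes A_{j,n}$ with $2\times2$ matrices $A_{j,i}$; such a sum with $r$ minimal is a Schmidt decomposition. A unitary $U$ is genuine if it is not a tensor product of two unitaries across any bipartition of the qubits into two nonempty parts. For a genuine unitary $U$ of Schmidt rank two, the singular number is the number of singular matrices among the $2n$ local matrices of a Schmidt decomposition of $U$. Let $\mathcal C(n,2,k)$ be the set of genuine $n$-qubit unitaries of Schmidt rank two with singular number $k$. Two $n$-qubit operators $X,Y$ are locally equivalent if $Y=(V_1\otimes\cdots\otimes V_n)X(W_1\otimes\cdots\otimes W_n)$ for some $2\times 2$ unitaries $V_i,W_i$. Write $\sigma_3=\mathrm{diag}(1,-1)$ and $I$ for the $2\times2$ identity. The singular number of every genuine $n$-qubit unitary of Schmidt rank two is well defined (the same for all its Schmidt decompositions) and lies in $\{0,1,2,n-1,n\}$. For each such $k$, the set $\mathcal C(n,2,k)$ consists exactly of the operators that are, up to a permutation of the qubits, locally equivalent to one of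 the following: (i) $k=n$: $\; I^{\otimes n}+(e^{i\theta}-1)|0\rangle\langle 0|^{\otimes n}$ with $\theta\in(0,2\pi)$; (ii) $k=n-1$: $\; I^{\otimes n}+|0\rangle\langle0|^{\otimes(n-1)}\otimes\mathrm{diag}(e^{i\theta}-1,e^{i\phi}-1)$ with $\theta,\phi\in(0,2\pi)$, $\theta\ne\phi$; (iii) $k=2$: $\; |0\rangle\langle0|\otimes I^{\otimes(n-1)}+|1\rangle\langle1|\otimes\mathrm{diag}(1,e^{i\beta_2})\otimes\cdots\otimes\mathrm{diag}(1,e^{i\beta_n})$ with $\beta_2,\dots,\beta_n\in(0,2\pi)$; (iv) $k=1$: $\; i\cos\alpha\,|0\rangle\langle0|\otimes\sigma_3^{\otimes(n-1)}+\mathrm{diag}(\sin\alpha,1)\otimes I^{\otimes(n-1)}$ with $\alpha\in(0,\tfrac\pi2)\cup(\tfrac\pi2,\pi)$; (v) $k=0$: $\; \mathrm{diag}(\cos\alpha,\cos\beta)\otimes I^{\otimes(n-1)}+i\,\mathrm{diag}(\sin\alpha,\sin\beta)\otimes\sigma_3^{\otimes(n-1)}$ with $\alpha,\beta\in[0,2\pi)\setminus\{0,\tfrac\pi2,\pi,\tfrac{3\pi}2\}$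 and $\sin(\alpha-\beta)\ne0$. -/

import Mathlib

/-- Operators on a single qubit. -/
abbrev QubitOp : Type := Matrix (Fin 2) (Fin 2) ℂ

/-- Operators on the `n`-qubit space `(ℂ²)^{⊗ n}`, written in the computational basis, which is
indexed by bit strings `Fin n → Fin 2`. -/
abbrev NQubitOp (n : ℕ) : Type := Matrix (Fin n → Fin 2) (Fin n → Fin 2) ℂ

/-- The product operator `A 0 ⊗ A 1 ⊗ ⋯ ⊗ A (n - 1)`. -/
def prodOp {n : ℕ} (A : Fin n → QubitOp) : NQubitOp n :=
  Matrix.of fun x y => ∏ i, A i (x i) (y i)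

/-- The operator Schmidt rank: the least number of product operators that sum to `U`.
(Such a number always exists, because the matrix units are product operators.) -/
noncomputable def schmidtRank {n : ℕ} (U : NQubitOp n) : ℕ :=
  sInf {r : ℕ | ∃ A : Fin r → Fin n → QubitOp, U = ∑ j, prodOp (A j)}

/-- `U = V ⊗ W` for unitary operators `V` on the qubits in `S` and `W` on the remaining ones. -/
def IsProductAcross {n : ℕ} (U : NQubitOp n) (S : Finset (Fin n)) : Prop :=
  ∃ V ∈ Matrix.unitaryGroup ({i : Fin n // i ∈ S} → Fin 2) ℂ,
    ∃ W ∈ Matrix.unitaryGroup ({i : Fin n // i ∉ S} → Fin 2) ℂ,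
      ∀ x y : Fin n → Fin 2,
        U x y = V (fun i => x i.1) (fun i => y i.1) * W (fun i => x i.1) (fun i => y i.1)

/-- A genuine `n`-qubit unitary gate of Schmidt rank two: a unitary operator of Schmidt rank two
that is not a tensor product of two unitary gates across any bipartition of the qubits into two
nonempty parts. -/
structure IsGenuineSR2Gate {n : ℕ} (U : NQubitOp n) : Prop where
  unitary : U ∈ Matrix.unitaryGroup (Fin n → Fin 2) ℂ
  schmidtRank_eq : schmidtRank U = 2
  genuine : ∀ S : Finset (Fin n), S.Nonempty → S ≠ Finset.univ → ¬ IsProductAcross U S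

/-- `U = ∑ j, A j 0 ⊗ ⋯ ⊗ A j (n - 1)` is a Schmidt decomposition: the number of terms is
minimal. -/
def IsSchmidtDecomposition {n r : ℕ} (U : NQubitOp n) (A : Fin r → Fin n → QubitOp) : Prop :=
  schmidtRank U = r ∧ U = ∑ j, prodOp (A j)

/-- The number of singular local operators in a family of local operators. -/
noncomputable def singularCount {n r : ℕ} (A : Fin r → Fin n → QubitOp) : ℕ :=
  Set.ncard {p : Fin r × Fin n | (A p.1 p.2).det = 0}

/-- `k` is the number of singular local operators in a Schmidt decomposition of the
Schmidt-rank-two operator `U`. -/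
def HasSingularNumber {n : ℕ} (U : NQubitOp n) (k : ℕ) : Prop :=
  ∃ A : Fin 2 → Fin n → QubitOp, IsSchmidtDecomposition U A ∧ singularCount A = k

/-- The set of genuine `n`-qubit unitary gates of Schmidt rank two with singular number `k`. -/
def genuineSR2Class (n k : ℕ) : Set (NQubitOp n) :=
  {U | IsGenuineSR2Gate U ∧ HasSingularNumber U k}

/-- Local unitary equivalence: `Y = (V₁ ⊗ ⋯ ⊗ Vₙ) X (W₁ ⊗ ⋯ ⊗ Wₙ)` with all `Vᵢ`, `Wᵢ` unitary. -/
def LUEquivalent {n : ℕ} (X Y : NQubitOp n) : Prop :=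
  ∃ V W : Fin n → QubitOp,
    (∀ i, V i ∈ Matrix.unitaryGroup (Fin 2) ℂ) ∧ (∀ i, W i ∈ Matrix.unitaryGroup (Fin 2) ℂ) ∧
      Y = prodOp V * X * prodOp W

/-- The operator obtained from `U` by permuting the qubits. -/
def permuteQubits {n : ℕ} (σ : Equiv.Perm (Fin n)) (U : NQubitOp n) : NQubitOp n :=
  U.submatrix (fun x => x ∘ σ) (fun x => x ∘ σ)

/-- Local unitary equivalence up to a permutation of the qubits. -/
def PermLUEquivalent {n : ℕ} (X Y : NQubitOp n) : Prop :=
  ∃ σ : Equiv.Perm (Fin n), LUEquivalent (permuteQubits σ X) Y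

/-- The diagonal single-qubit operator `diag(a, b)`. -/
def diagOp (a b : ℂ) : QubitOp := Matrix.diagonal ![a, b]

/-- `|0⟩⟨0|`. -/
def ketbra0 : QubitOp := diagOp 1 0

/-- `|1⟩⟨1|`. -/
def ketbra1 : QubitOp := diagOp 0 1

/-- The Pauli matrix `σ₃ = diag(1, -1)`. -/
def sigma3 : QubitOp := diagOp 1 (-1)

/-- The product operator `A ⊗ B 1 ⊗ ⋯ ⊗ B (n - 1)`; the value `B 0` is not used. -/
def firstRest {n : ℕ} (A : QubitOp) (B : Fin n → QubitOp) : NQubitOp n :=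
  prodOp fun i => if (i : ℕ) = 0 then A else B i

/-- The product operator `B ⊗ ⋯ ⊗ B ⊗ A` with `n - 1` factors `B`. -/
def restLast {n : ℕ} (B A : QubitOp) : NQubitOp n :=
  prodOp fun i => if (i : ℕ) + 1 = n then A else B

/-- `I ⊗ ⋯ ⊗ I + (e^{iθ} - 1) |0⟩⟨0|^{⊗ n}`. -/
noncomputable def formAll (n : ℕ) (θ : ℝ) : NQubitOp n :=
  prodOp (fun _ => 1) + (Complex.exp (Complex.I * θ) - 1) • prodOp (fun _ => ketbra0)

/-- `I ⊗ ⋯ ⊗ I + |0⟩⟨0|^{⊗ (n-1)} ⊗ diag(e^{iθ} - 1, e^{iφ} - 1)`. -/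
noncomputable def formAllButOne (n : ℕ) (θ φ : ℝ) : NQubitOp n :=
  prodOp (fun _ => 1) +
    restLast ketbra0 (diagOp (Complex.exp (Complex.I * θ) - 1) (Complex.exp (Complex.I * φ) - 1))

/-- `|0⟩⟨0| ⊗ I ⊗ ⋯ ⊗ I + |1⟩⟨1| ⊗ diag(1, e^{iβ₂}) ⊗ ⋯ ⊗ diag(1, e^{iβₙ})`
(the angle at index `0` is not used). -/
noncomputable def formTwo (n : ℕ) (β : Fin n → ℝ) : NQubitOp n :=
  firstRest ketbra0 (fun _ => 1) +
    firstRest ketbra1 (fun i => diagOp 1 (Complex.exp (Complex.I * β i)))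

/-- `i cos α |0⟩⟨0| ⊗ σ₃^{⊗ (n-1)} + diag(sin α, 1) ⊗ I^{⊗ (n-1)}`. -/
noncomputable def formOne (n : ℕ) (α : ℝ) : NQubitOp n :=
  (Complex.I * (Real.cos α : ℂ)) • firstRest ketbra0 (fun _ => sigma3) +
    firstRest (diagOp (Real.sin α : ℂ) 1) (fun _ => 1)

/-- `diag(cos α, cos β) ⊗ I^{⊗ (n-1)} + i diag(sin α, sin β) ⊗ σ₃^{⊗ (n-1)}`. -/
noncomputable def formZero (n : ℕ) (α β : ℝ) : NQubitOp n :=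
  firstRest (diagOp (Real.cos α : ℂ) (Real.cos β : ℂ)) (fun _ => 1) +
    Complex.I • firstRest (diagOp (Real.sin α : ℂ) (Real.sin β : ℂ)) (fun _ => sigma3)

/-- Angles in `[0, 2π)` different from `0, π/2, π, 3π/2`. -/
def nonQuarterAngles : Set ℝ :=
  {α | α ∈ Set.Ico 0 (2 * Real.pi) ∧ ∀ j : Fin 4, α ≠ ((j : ℕ) : ℝ) * Real.pi / 2}

/-! Write a gate as `prodOp A + prodOp B`. If the factors `A i`, `B i` were proportional, qubit `i`
would split off, so genuineness forces linear independence at every site. Conversely, independence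
at every site gives Schmidt rank two and excludes every product structure, because product
functionals dual to the `A i` and the `B i` detect the entanglement
(`not_mix_of_linearIndependent`). The same functionals show that for at least three qubits the two
product terms are unique up to order and local scalars, so the singular number is well defined.

At each site some nonzero element of the span of `A i`, `B i` is singular. A singular value
decomposition turns it into `diag(l, 0)`, and the off-diagonal block of `U U* = 1` then makes the
other factor diagonal (`exists_isDiag_of_kronecker`). Hence `U` is locally equivalent to a diagonal
gate whose entries `∏ a i (x i) + ∏ b i (x i)` have modulus one.

Expanding the squared modulus gives a linear relation between five product vectors: `|a|²`, `|b|²`,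
the two mixed terms and the constant one. A product functional that kills four of them at four
different sites kills the fifth. This needs four qubits, and shows that one of the two terms has
constant modulus at all sites but one (`exists_forall_ne_norm_eq`). Removing its phases leaves
`reducedOp d c w` with `w j = ![1, w j]`.

What remains is plane geometry: `d s + c s * ∏ j ∈ S, w j` lies on the unit circle for all `s` and
`S`. If no `w j` vanishes and some `d s`, `c s` are both nonzero, two distinct circles meet in at
most two points, which forces `w j = -1` and gives the families for `k = 0, 1`. If `d s` or `c s`
vanishes for each `s`, the gate is controlled, which is `k = 2`. If some `w j` vanishes, then `d`
can be normalised to one, and inverting the circle `‖1 + z‖ = 1` in the origin shows that at most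
one site has two nonzero entries, which gives `k = n, n - 1`. Since each family has a known singular
number, uniqueness of that number matches families with classes. -/

/-! ### Algebra of product operators and local equivalence. -/

section ProductOperators

variable {n : ℕ}

theorem prodOp_apply (A : Fin n → QubitOp) (x y : Fin n → Fin 2) :
    prodOp A x y = ∏ i, A i (x i) (y i) := rfl

theorem prodOp_mul (A B : Fin n → QubitOp) :
    prodOp A * prodOp B = prodOp (fun i => A i * B i) := by
  ext x y
  simp only [Matrix.mul_apply, prodOp_apply]
  rw [Finset.prod_univ_sum, Fintype.piFinset_univ]
  simp only [Finset.prod_mul_distrib]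

theorem prodOp_one : prodOp (fun _ : Fin n => (1 : QubitOp)) = 1 := by
  ext x y
  simp only [prodOp_apply, Matrix.one_apply]
  rw [Finset.prod_ite_zero]
  simp [funext_iff]

theorem prodOp_conjTranspose (A : Fin n → QubitOp) :
    (prodOp A).conjTranspose = prodOp (fun i => (A i).conjTranspose) := by
  ext x y
  simp [prodOp_apply, Matrix.conjTranspose_apply]

theorem trace_prodOp (A : Fin n → QubitOp) :
    (prodOp A).trace = ∏ i, (A i).trace := by
  simp only [Matrix.trace, Matrix.diag_apply, prodOp_apply]
  rw [Finset.prod_univ_sum, Fintype.piFinset_univ]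

theorem prodOp_mem_unitaryGroup {V : Fin n → QubitOp}
    (hV : ∀ i, V i ∈ Matrix.unitaryGroup (Fin 2) ℂ) :
    prodOp V ∈ Matrix.unitaryGroup (Fin n → Fin 2) ℂ := by
  rw [Matrix.mem_unitaryGroup_iff, Matrix.star_eq_conjTranspose, prodOp_conjTranspose, prodOp_mul,
    ← prodOp_one]
  congr 1
  ext1 i
  exact Matrix.mem_unitaryGroup_iff.1 (hV i)

theorem permuteQubits_prodOp (σ : Equiv.Perm (Fin n)) (A : Fin n → QubitOp) :
    permuteQubits σ (prodOp A) = prodOp (fun i => A (σ.symm i)) := by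
  ext x y
  simp only [permuteQubits, Matrix.submatrix_apply, prodOp_apply, Function.comp_apply]
  rw [← Equiv.prod_comp σ fun i => A (σ.symm i) (x i) (y i)]
  simp

/-- Relabelling of bit strings by a permutation of the qubits. -/
def bitPerm (σ : Equiv.Perm (Fin n)) : (Fin n → Fin 2) ≃ (Fin n → Fin 2) where
  toFun x := x ∘ σ
  invFun x := x ∘ σ.symm
  left_inv x := by ext; simp
  right_inv x := by ext; simp

theorem permuteQubits_mul (σ : Equiv.Perm (Fin n)) (X Y : NQubitOp n) :
    permuteQubits σ (X * Y) = permuteQubits σ X * permuteQubits σ Y :=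
  (Matrix.submatrix_mul_equiv X Y _ (bitPerm σ) _).symm

theorem permuteQubits_add (σ : Equiv.Perm (Fin n)) (X Y : NQubitOp n) :
    permuteQubits σ (X + Y) = permuteQubits σ X + permuteQubits σ Y := rfl

theorem permuteQubits_one (σ : Equiv.Perm (Fin n)) :
    permuteQubits σ (1 : NQubitOp n) = 1 :=
  Matrix.submatrix_one_equiv (bitPerm σ)

theorem permuteQubits_permuteQubits (σ τ : Equiv.Perm (Fin n)) (X : NQubitOp n) :
    permuteQubits σ (permuteQubits τ X) = permuteQubits (σ * τ) X := rfl

theorem permuteQubits_mem_unitaryGroup (σ : Equiv.Perm (Fin n)) {X : NQubitOp n}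
    (hX : X ∈ Matrix.unitaryGroup (Fin n → Fin 2) ℂ) :
    permuteQubits σ X ∈ Matrix.unitaryGroup (Fin n → Fin 2) ℂ := by
  rw [Matrix.mem_unitaryGroup_iff] at hX ⊢
  have h : star (permuteQubits σ X) = permuteQubits σ (star X) := rfl
  rw [h, ← permuteQubits_mul, hX, permuteQubits_one]

theorem PermLUEquivalent.trans {X Y Z : NQubitOp n} (h₁ : PermLUEquivalent X Y)
    (h₂ : PermLUEquivalent Y Z) : PermLUEquivalent X Z := by
  obtain ⟨σ, V, W, hV, hW, rfl⟩ := h₁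
  obtain ⟨τ, V', W', hV', hW', rfl⟩ := h₂
  refine ⟨τ * σ, fun i => V' i * V (τ.symm i), fun i => W (τ.symm i) * W' i,
    fun i => mul_mem (hV' i) (hV _), fun i => mul_mem (hW _) (hW' i), ?_⟩
  simp only [permuteQubits_mul, permuteQubits_prodOp, permuteQubits_permuteQubits, ← prodOp_mul,
    mul_assoc]

theorem PermLUEquivalent.symm {X Y : NQubitOp n} (h : PermLUEquivalent X Y) :
    PermLUEquivalent Y X := by
  obtain ⟨σ, V, W, hV, hW, rfl⟩ := h
  refine ⟨σ⁻¹, fun i => star (V (σ i)), fun i => star (W (σ i)),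
    fun i => Unitary.star_mem (hV _), fun i => Unitary.star_mem (hW _), ?_⟩
  simp only [permuteQubits_mul, permuteQubits_prodOp, permuteQubits_permuteQubits]
  have h1 : ∀ i, star (V (σ i)) * V (σ⁻¹.symm i) = 1 := fun i =>
    Matrix.mem_unitaryGroup_iff'.1 (hV _)
  have h2 : ∀ i, W (σ⁻¹.symm i) * star (W (σ i)) = 1 := fun i =>
    Matrix.mem_unitaryGroup_iff.1 (hW _)
  rw [mul_assoc, mul_assoc, prodOp_mul, ← mul_assoc, ← mul_assoc, prodOp_mul]
  simp only [h1, h2, prodOp_one, one_mul, mul_one, inv_mul_cancel]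
  rfl

theorem PermLUEquivalent.mem_unitaryGroup {X Y : NQubitOp n} (h : PermLUEquivalent X Y)
    (hX : X ∈ Matrix.unitaryGroup (Fin n → Fin 2) ℂ) :
    Y ∈ Matrix.unitaryGroup (Fin n → Fin 2) ℂ := by
  obtain ⟨σ, V, W, hV, hW, rfl⟩ := h
  exact mul_mem (mul_mem (prodOp_mem_unitaryGroup hV) (permuteQubits_mem_unitaryGroup σ hX))
    (prodOp_mem_unitaryGroup hW)

end ProductOperators

/-! ### Product functionals and uniqueness of the two-term decomposition. -/

section TraceFunctionals

theorem exists_trace_eq_one_of_notMem_span {A B : QubitOp} (h : A ∉ Submodule.span ℂ {B}) :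
    ∃ φ : QubitOp, (φ * B).trace = 0 ∧ (φ * A).trace = 1 := by
  obtain ⟨f, hf, hB⟩ := Submodule.exists_le_ker_of_notMem h
  have key : ∀ M : QubitOp, ((f A)⁻¹ •
      Matrix.of (fun s t => f (Matrix.single t s 1)) * M).trace = (f A)⁻¹ * f M := by
    intro M
    have hM : f M = ∑ s, ∑ t, M s t * f (Matrix.single s t 1) := by
      conv_lhs => rw [Matrix.matrix_eq_sum_single M]
      simp only [map_sum]
      refine Finset.sum_congr rfl fun s _ => Finset.sum_congr rfl fun t _ => ?_
      rw [← smul_eq_mul, ← map_smul, Matrix.smul_single, smul_eq_mul, mul_one]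
    rw [hM, Matrix.smul_mul, Matrix.trace_smul, smul_eq_mul]
    congr 1
    simp only [Matrix.trace, Matrix.diag_apply, Matrix.mul_apply, Matrix.of_apply]
    rw [Finset.sum_comm]
    refine Finset.sum_congr rfl fun s _ => Finset.sum_congr rfl fun t _ => mul_comm _ _
  refine ⟨_, (key B).trans ?_, (key A).trans (inv_mul_cancel₀ hf)⟩
  have : f B = 0 := hB (Submodule.mem_span_singleton_self B)
  rw [this, mul_zero]

theorem LinearIndependent.notMem_span_singleton {E : Type*} [AddCommGroup E] [Module ℂ E]
    {A B : E} (h : LinearIndependent ℂ ![A, B]) : A ∉ Submodule.span ℂ {B} := by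
  rw [LinearIndependent.pair_iff] at h
  intro hA
  obtain ⟨c, rfl⟩ := Submodule.mem_span_singleton.1 hA
  have := (h 1 (-c) (by simp)).1
  simp at this

theorem LinearIndependent.pair_swap {E : Type*} [AddCommGroup E] [Module ℂ E]
    {A B : E} (h : LinearIndependent ℂ ![A, B]) : LinearIndependent ℂ ![B, A] := by
  rw [LinearIndependent.pair_iff] at h ⊢
  intro s t hst
  exact (h t s (by rw [add_comm]; exact hst)).symm

theorem LinearIndependent.pair_left_ne_zero {E : Type*} [AddCommGroup E] [Module ℂ E]
    {A B : E} (h : LinearIndependent ℂ ![A, B]) : A ≠ 0 := h.ne_zero 0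

variable {n : ℕ}

theorem trace_prodOp_mul_prodOp (φ A : Fin n → QubitOp) :
    (prodOp φ * prodOp A).trace = ∏ i, (φ i * A i).trace := by
  rw [prodOp_mul, trace_prodOp]

theorem exists_fin_ne_ne (hn : 3 ≤ n) (j k : Fin n) : ∃ l : Fin n, l ≠ j ∧ l ≠ k := by
  have : ∃ l ∈ (Finset.univ : Finset (Fin n)), l ∉ ({j, k} : Finset (Fin n)) :=
    Finset.exists_mem_notMem_of_card_lt_card
      (lt_of_le_of_lt Finset.card_le_two (by simp; omega))
  obtain ⟨l, -, hl⟩ := this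
  exact ⟨l, by simpa [not_or] using hl⟩

/-- Otherwise pair both sides with a product functional that kills `a j` at `j` and `b k` at `k`, is
1 on `c j` and `c k` there, and elsewhere kills `d i` and is 1 on `c i`. The left side gives 0 and
the right side 1; a third site is needed to kill `prodOp d`. -/
theorem mem_span_or_mem_span_of_sum_prodOp_eq (hn : 3 ≤ n) {a b c d : Fin n → QubitOp}
    (h : prodOp a + prodOp b = prodOp c + prodOp d)
    (hcd : ∀ i, LinearIndependent ℂ ![c i, d i]) {j k : Fin n} (hjk : j ≠ k) :
    c j ∈ Submodule.span ℂ {a j} ∨ c k ∈ Submodule.span ℂ {b k} := by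
  by_contra! hne
  obtain ⟨ψ, hψ0, hψ1⟩ := exists_trace_eq_one_of_notMem_span hne.1
  obtain ⟨χ, hχ0, hχ1⟩ := exists_trace_eq_one_of_notMem_span hne.2
  choose γ hγ0 hγ1 using fun i => exists_trace_eq_one_of_notMem_span (hcd i).notMem_span_singleton
  obtain ⟨l, hlj, hlk⟩ := exists_fin_ne_ne hn j k
  set φ : Fin n → QubitOp := Function.update (Function.update γ j ψ) k χ with hφ
  have hφk : φ k = χ := by simp [hφ]
  have hφj : φ j = ψ := by simp [hφ, hjk]
  have hφo : ∀ i, i ≠ j → i ≠ k → φ i = γ i := fun i h1 h2 => by simp [hφ, h1, h2]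
  have := congrArg (fun U => (prodOp φ * U).trace) h
  simp only [mul_add, Matrix.trace_add, trace_prodOp_mul_prodOp] at this
  rw [Finset.prod_eq_zero (Finset.mem_univ j) (by rw [hφj, hψ0]),
    Finset.prod_eq_zero (Finset.mem_univ k) (by rw [hφk, hχ0]),
    Finset.prod_eq_zero (i := l) (f := fun i => (φ i * d i).trace) (Finset.mem_univ l)
      (by rw [hφo l hlj hlk, hγ0]),
    Finset.prod_eq_one] at this
  · simp at this
  · intro i _
    by_cases hk : i = k
    · rw [hk, hφk, hχ1]
    by_cases hj : i = j
    · rw [hj, hφj, hψ1]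
    rw [hφo i hj hk, hγ1]

theorem forall_mem_span_or_of_sum_prodOp_eq (hn : 3 ≤ n) {a b c d : Fin n → QubitOp}
    (h : prodOp a + prodOp b = prodOp c + prodOp d)
    (hab : ∀ i, LinearIndependent ℂ ![a i, b i])
    (hcd : ∀ i, LinearIndependent ℂ ![c i, d i]) :
    (∀ i, c i ∈ Submodule.span ℂ {a i}) ∨ (∀ i, c i ∈ Submodule.span ℂ {b i}) := by
  by_contra! hne
  obtain ⟨⟨j, hj⟩, k, hk⟩ := hne
  have key := fun {j k : Fin n} (hjk : j ≠ k) =>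
    mem_span_or_mem_span_of_sum_prodOp_eq hn h hcd hjk
  -- If both alternatives fail at the same site, then at any other site `l` the vector `c l` is a
  -- multiple of both `a l` and `b l`, hence zero.
  obtain rfl | hjk := eq_or_ne j k
  · obtain ⟨l, hl, -⟩ := exists_fin_ne_ne hn j j
    obtain ⟨s, hs⟩ := Submodule.mem_span_singleton.1 ((key hl).resolve_right hk)
    obtain ⟨t, ht⟩ := Submodule.mem_span_singleton.1 ((key hl.symm).resolve_left hj)
    have h0 := LinearIndependent.pair_iff.1 (hab l) s (-t) (by rw [neg_smul, hs, ht]; simp)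
    rw [h0.1, zero_smul] at hs
    exact (hcd l).pair_left_ne_zero hs.symm
  · exact (key hjk).elim hj hk

theorem not_mem_span_and_mem_span {a c d : QubitOp} (h : LinearIndependent ℂ ![c, d])
    (hc : c ∈ Submodule.span ℂ {a}) (hd : d ∈ Submodule.span ℂ {a}) : False := by
  obtain ⟨s, rfl⟩ := Submodule.mem_span_singleton.1 hc
  obtain ⟨t, rfl⟩ := Submodule.mem_span_singleton.1 hd
  have h0 := LinearIndependent.pair_iff.1 h t (-s)
    (by rw [smul_smul, smul_smul, ← add_smul]; simp [mul_comm])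
  rw [neg_eq_zero] at h0
  exact h.pair_left_ne_zero (by rw [h0.2, zero_smul])

theorem det_eq_zero_iff_of_mem_span {a c : QubitOp} (h : c ∈ Submodule.span ℂ {a}) (hc : c ≠ 0) :
    c.det = 0 ↔ a.det = 0 := by
  obtain ⟨s, rfl⟩ := Submodule.mem_span_singleton.1 h
  have hs : s ≠ 0 := fun h0 => hc (by rw [h0, zero_smul])
  rw [Matrix.det_smul]
  simp [hs]

theorem singularCount_eq (A : Fin 2 → Fin n → QubitOp) :
    singularCount A = {i | (A 0 i).det = 0}.ncard + {i | (A 1 i).det = 0}.ncard := by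
  rw [singularCount]
  have : {p : Fin 2 × Fin n | (A p.1 p.2).det = 0} =
      Prod.mk 0 '' {i | (A 0 i).det = 0} ∪ Prod.mk 1 '' {i | (A 1 i).det = 0} := by
    ext ⟨j, i⟩
    fin_cases j <;> simp
  rw [this, Set.ncard_union_eq, Set.ncard_image_of_injective _ (Prod.mk_right_injective _),
    Set.ncard_image_of_injective _ (Prod.mk_right_injective _)]
  · rw [Set.disjoint_left]
    rintro _ ⟨i, -, rfl⟩ ⟨j, -, h⟩
    simp at h

/-- Uniqueness of the number of singular factors of a sum of two product operators. -/
theorem singularCount_eq_of_sum_prodOp_eq (hn : 3 ≤ n) {A C : Fin 2 → Fin n → QubitOp}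
    (h : prodOp (A 0) + prodOp (A 1) = prodOp (C 0) + prodOp (C 1))
    (hA : ∀ i, LinearIndependent ℂ ![A 0 i, A 1 i])
    (hC : ∀ i, LinearIndependent ℂ ![C 0 i, C 1 i]) :
    singularCount A = singularCount C := by
  have h' : prodOp (A 0) + prodOp (A 1) = prodOp (C 1) + prodOp (C 0) := by
    rw [h, add_comm]
  have hC' := fun i => (hC i).pair_swap
  let i₀ : Fin n := ⟨0, by omega⟩
  rw [singularCount_eq, singularCount_eq]
  -- `C 0` and `C 1` cannot both be proportional to the same term, so only the matched and the
  -- exchanged pairing survive.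
  rcases forall_mem_span_or_of_sum_prodOp_eq hn h hA hC with h0 | h0 <;>
    rcases forall_mem_span_or_of_sum_prodOp_eq hn h' hA hC' with h1 | h1
  · exact (not_mem_span_and_mem_span (hC i₀) (h0 _) (h1 _)).elim
  · simp only [fun i => det_eq_zero_iff_of_mem_span (h0 i) (hC i).pair_left_ne_zero,
      fun i => det_eq_zero_iff_of_mem_span (h1 i) (hC' i).pair_left_ne_zero]
  · simp only [fun i => det_eq_zero_iff_of_mem_span (h0 i) (hC i).pair_left_ne_zero,
      fun i => det_eq_zero_iff_of_mem_span (h1 i) (hC' i).pair_left_ne_zero]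
    rw [add_comm]
  · exact (not_mem_span_and_mem_span (hC i₀) (h0 _) (h1 _)).elim

end TraceFunctionals

/-! ### Independent local factors give genuine gates of Schmidt rank two. -/

section Genuineness

variable {n : ℕ}

/-- The bit string that agrees with `x` on `S` and with `y` off `S`. -/
def mixBits (S : Finset (Fin n)) (x y : Fin n → Fin 2) : Fin n → Fin 2 :=
  fun i => if i ∈ S then x i else y i

/-- Exchange of the coordinates off `S` of two bit strings. -/
def mixEquiv (S : Finset (Fin n)) :
    (Fin n → Fin 2) × (Fin n → Fin 2) ≃ (Fin n → Fin 2) × (Fin n → Fin 2) where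
  toFun p := (mixBits S p.1 p.2, mixBits S p.2 p.1)
  invFun p := (mixBits S p.1 p.2, mixBits S p.2 p.1)
  left_inv p := by ext i <;> simp only [mixBits] <;> split_ifs <;> rfl
  right_inv p := by ext i <;> simp only [mixBits] <;> split_ifs <;> rfl

theorem prodOp_mixBits (S : Finset (Fin n)) (φ ψ : Fin n → QubitOp) (x y x' y' : Fin n → Fin 2) :
    prodOp φ (mixBits S x x') (mixBits S y y') * prodOp ψ (mixBits S x' x) (mixBits S y' y) =
      prodOp (fun i => if i ∈ S then φ i else ψ i) x y *
        prodOp (fun i => if i ∈ S then ψ i else φ i) x' y' := by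
  simp only [prodOp_apply, ← Finset.prod_mul_distrib, mixBits]
  refine Finset.prod_congr rfl fun i _ => ?_
  split_ifs
  · rfl
  · rw [mul_comm]

/-- The hypothesis says that `U ⊗ U` is invariant under exchanging the two copies of the qubits off
`S`, so the exchange may be moved onto the functionals. -/
theorem trace_mul_trace_eq_of_mix {S : Finset (Fin n)} {U : NQubitOp n}
    (hU : ∀ x y x' y', U x y * U x' y' =
      U (mixBits S x x') (mixBits S y y') * U (mixBits S x' x) (mixBits S y' y))
    (φ ψ : Fin n → QubitOp) :
    (prodOp φ * U).trace * (prodOp ψ * U).trace =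
      (prodOp (fun i => if i ∈ S then φ i else ψ i) * U).trace *
        (prodOp (fun i => if i ∈ S then ψ i else φ i) * U).trace := by
  have key : ∀ φ ψ : Fin n → QubitOp, (prodOp φ * U).trace * (prodOp ψ * U).trace =
      ∑ p : (Fin n → Fin 2) × (Fin n → Fin 2), ∑ q : (Fin n → Fin 2) × (Fin n → Fin 2),
        (prodOp φ p.1 q.1 * prodOp ψ p.2 q.2) * (U q.1 p.1 * U q.2 p.2) := by
    intro φ ψ
    simp only [Matrix.trace, Matrix.diag_apply, Matrix.mul_apply]
    rw [Finset.sum_mul_sum, Fintype.sum_prod_type]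
    refine Finset.sum_congr rfl fun x _ => Finset.sum_congr rfl fun x' _ => ?_
    rw [Finset.sum_mul_sum, Fintype.sum_prod_type]
    refine Finset.sum_congr rfl fun y _ => Finset.sum_congr rfl fun y' _ => ?_
    ring
  rw [key, key, ← (mixEquiv S).sum_comp]
  refine Finset.sum_congr rfl fun p _ => ?_
  rw [← (mixEquiv S).sum_comp]
  refine Finset.sum_congr rfl fun q _ => ?_
  simp only [mixEquiv, Equiv.coe_fn_mk]
  rw [prodOp_mixBits, ← hU]

/-- With `α` dual to `A` and `β` dual to `B`, both traces of the unmixed functionals are 1. The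
functional equal to `α` on `S` and `β` off `S` kills `prodOp B` at a site of `S` and `prodOp A` at a
site off `S`. This one contradiction rules out both lower Schmidt rank and product structure. -/
theorem not_mix_of_linearIndependent {S : Finset (Fin n)} (hS : S.Nonempty)
    (hS' : S ≠ Finset.univ) {A B : Fin n → QubitOp}
    (hAB : ∀ i, LinearIndependent ℂ ![A i, B i])
    (hU : ∀ x y x' y', (prodOp A + prodOp B) x y * (prodOp A + prodOp B) x' y' =
      (prodOp A + prodOp B) (mixBits S x x') (mixBits S y y') *
        (prodOp A + prodOp B) (mixBits S x' x) (mixBits S y' y)) : False := by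
  choose α hα0 hα1 using fun i => exists_trace_eq_one_of_notMem_span (hAB i).notMem_span_singleton
  choose β hβ0 hβ1 using
    fun i => exists_trace_eq_one_of_notMem_span (hAB i).pair_swap.notMem_span_singleton
  obtain ⟨j, hj⟩ := hS
  obtain ⟨k, hk⟩ : ∃ k, k ∉ S := by
    by_contra! h
    exact hS' (Finset.eq_univ_iff_forall.2 h)
  have h := trace_mul_trace_eq_of_mix hU α β
  simp only [mul_add, Matrix.trace_add, trace_prodOp_mul_prodOp] at h
  rw [Finset.prod_eq_one fun i _ => hα1 i, Finset.prod_eq_one fun i _ => hβ1 i,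
    Finset.prod_eq_zero (Finset.mem_univ j) (hα0 j),
    Finset.prod_eq_zero (Finset.mem_univ j) (hβ0 j),
    Finset.prod_eq_zero (i := k) (f := fun i => ((if i ∈ S then α i else β i) * A i).trace)
      (Finset.mem_univ k) (by rw [if_neg hk, hβ0]),
    Finset.prod_eq_zero (i := j) (f := fun i => ((if i ∈ S then α i else β i) * B i).trace)
      (Finset.mem_univ j) (by rw [if_pos hj, hα0])] at h
  simp at h

theorem prodOp_mix (S : Finset (Fin n)) (C : Fin n → QubitOp) (x y x' y' : Fin n → Fin 2) :
    prodOp C x y * prodOp C x' y' =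
      prodOp C (mixBits S x x') (mixBits S y y') * prodOp C (mixBits S x' x) (mixBits S y' y) := by
  rw [prodOp_mixBits]
  simp

theorem IsProductAcross.mix {S : Finset (Fin n)} {U : NQubitOp n} (h : IsProductAcross U S)
    (x y x' y' : Fin n → Fin 2) :
    U x y * U x' y' =
      U (mixBits S x x') (mixBits S y y') * U (mixBits S x' x) (mixBits S y' y) := by
  obtain ⟨V, -, W, -, hU⟩ := h
  have h1 : ∀ x y : Fin n → Fin 2, (fun i : {i // i ∈ S} => mixBits S x y i.1) = fun i => x i.1 :=
    fun x y => funext fun i => if_pos i.2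
  have h2 : ∀ x y : Fin n → Fin 2, (fun i : {i // i ∉ S} => mixBits S x y i.1) = fun i => y i.1 :=
    fun x y => funext fun i => if_neg i.2
  simp only [hU, h1, h2]
  ring

theorem schmidtRank_eq_two (hn : 2 ≤ n) {A B : Fin n → QubitOp}
    (hAB : ∀ i, LinearIndependent ℂ ![A i, B i]) :
    schmidtRank (prodOp A + prodOp B) = 2 := by
  let i₀ : Fin n := ⟨0, by omega⟩
  have hS : ({i₀} : Finset (Fin n)) ≠ Finset.univ := by
    intro h
    have := congrArg Finset.card h
    simp at this
    omega
  have h2 : 2 ∈ {r : ℕ | ∃ C : Fin r → Fin n → QubitOp,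
      prodOp A + prodOp B = ∑ j, prodOp (C j)} := ⟨![A, B], by simp⟩
  refine le_antisymm (Nat.sInf_le h2) ?_
  by_contra! hlt
  obtain ⟨r, hr, C, hC⟩ : ∃ r < 2, ∃ C : Fin r → Fin n → QubitOp,
      prodOp A + prodOp B = ∑ j, prodOp (C j) := ⟨_, hlt, Nat.sInf_mem ⟨2, h2⟩⟩
  refine not_mix_of_linearIndependent (Finset.singleton_nonempty i₀) hS hAB ?_
  rw [hC]
  interval_cases r
  · simp
  · simp only [Fin.sum_univ_one]
    exact prodOp_mix _ _

theorem isGenuineSR2Gate_of_linearIndependent (hn : 2 ≤ n) {A B : Fin n → QubitOp}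
    (hAB : ∀ i, LinearIndependent ℂ ![A i, B i])
    (hU : prodOp A + prodOp B ∈ Matrix.unitaryGroup (Fin n → Fin 2) ℂ) :
    IsGenuineSR2Gate (prodOp A + prodOp B) :=
  ⟨hU, schmidtRank_eq_two hn hAB, fun _ hS hS' h =>
    not_mix_of_linearIndependent hS hS' hAB h.mix⟩

end Genuineness

open scoped Kronecker ComplexConjugate

/-! ### Unitary sums of two Kronecker products are diagonalizable on the qubit factor. -/

section Kronecker

theorem exists_smul_of_not_linearIndependent {E : Type*} [AddCommGroup E] [Module ℂ E] {A B : E}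
    (h : ¬ LinearIndependent ℂ ![A, B]) : ∃ (M : E) (s t : ℂ), A = s • M ∧ B = t • M := by
  rw [LinearIndependent.pair_iff] at h
  push Not at h
  obtain ⟨s, t, hst, h⟩ := h
  by_cases hs : s = 0
  · have ht := h hs
    refine ⟨A, 1, 0, (one_smul _ _).symm, ?_⟩
    rw [hs, zero_smul, zero_add] at hst
    rw [zero_smul]
    exact (smul_eq_zero.1 hst).resolve_left ht
  · refine ⟨B, -(s⁻¹ * t), 1, ?_, (one_smul _ _).symm⟩
    have := congrArg (fun x => s⁻¹ • x) hst
    simp only [smul_add, smul_smul, inv_mul_cancel₀ hs, one_smul, smul_zero] at this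
    rw [neg_smul, ← eq_neg_iff_add_eq_zero.2 this]

variable {R S : Type*} [Fintype R] [DecidableEq R] [Fintype S] [DecidableEq S]

/-- `V V* ⊗ W W* = 1` makes both `V V*` and `W W*` scalar, and the scalar of `W W*` is a positive
real `r`; take `c = √r`. It is needed because `IsProductAcross` asks for unitary factors. -/
theorem exists_smul_mem_unitaryGroup_of_kronecker [Nonempty R] [Nonempty S] {V : Matrix R R ℂ}
    {W : Matrix S S ℂ} (h : V ⊗ₖ W ∈ Matrix.unitaryGroup (R × S) ℂ) :
    ∃ c : ℂ, c ≠ 0 ∧ c • V ∈ Matrix.unitaryGroup R ℂ ∧ c⁻¹ • W ∈ Matrix.unitaryGroup S ℂ := by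
  rw [Matrix.mem_unitaryGroup_iff, Matrix.star_eq_conjTranspose, Matrix.conjTranspose_kronecker,
    ← Matrix.mul_kronecker_mul] at h
  have key : ∀ i i' j j', (V * V.conjTranspose) i i' * (W * W.conjTranspose) j j' =
      (1 : Matrix R R ℂ) i i' * (1 : Matrix S S ℂ) j j' := fun i i' j j' => by
    have := congrFun (congrFun h (i, j)) (i', j')
    rw [← Matrix.one_kronecker_one] at this
    exact this
  obtain ⟨i₀⟩ := ‹Nonempty R›
  obtain ⟨j₀⟩ := ‹Nonempty S›
  set r : ℝ := ∑ k, ‖W j₀ k‖ ^ 2 with hr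
  have hW : (W * W.conjTranspose) j₀ j₀ = (r : ℂ) := by
    simp [Matrix.mul_apply, hr, Complex.mul_conj']
  have hr0 : 0 ≤ r := Finset.sum_nonneg fun k _ => by positivity
  have hrC : (r : ℂ) ≠ 0 := by
    intro h0
    have := key i₀ i₀ j₀ j₀
    rw [hW, h0] at this
    simp at this
  have hsq : ((√r : ℝ) : ℂ) * (√r : ℝ) = r := by
    rw [← Complex.ofReal_mul, Real.mul_self_sqrt hr0]
  have hs : ((√r : ℝ) : ℂ) ≠ 0 := fun h0 => hrC (by rw [← hsq, h0, zero_mul])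
  have hVV : (r : ℂ) • (V * V.conjTranspose) = 1 := by
    ext i i'
    have := key i i' j₀ j₀
    rw [hW] at this
    rw [Matrix.smul_apply, smul_eq_mul, mul_comm, this]
    simp
  have hWW : (r : ℂ)⁻¹ • (W * W.conjTranspose) = 1 := by
    ext j j'
    have h1 := key i₀ i₀ j j'
    have h2 := congrFun (congrFun hVV i₀) i₀
    simp only [Matrix.smul_apply, smul_eq_mul, Matrix.one_apply_eq, one_mul] at h1 h2 ⊢
    rw [← eq_inv_of_mul_eq_one_right h2, h1]
  refine ⟨(√r : ℝ), hs, ?_, ?_⟩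
  · rw [Matrix.mem_unitaryGroup_iff, star_smul, Matrix.star_eq_conjTranspose, smul_mul_smul_comm,
      ← hVV, ← hsq]
    simp
  · rw [Matrix.mem_unitaryGroup_iff, star_smul, Matrix.star_eq_conjTranspose, smul_mul_smul_comm,
      ← hWW, ← hsq, mul_inv]
    simp

/-- In `U U* = 1` the (1,1) block shows that `D` is invertible. The (0,1) block is a combination of
`C` and `D` times `D*`, so the combination itself vanishes, and independence kills the coefficient
`l * star (B 1 0)` of `C`. -/
theorem kronecker_entry_eq_zero_of_unitary {l : ℂ} (hl : l ≠ 0) {B : QubitOp} {C D : Matrix R R ℂ}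
    (hCD : LinearIndependent ℂ ![C, D])
    (h : diagOp l 0 ⊗ₖ C + B ⊗ₖ D ∈ Matrix.unitaryGroup (Fin 2 × R) ℂ) : B 1 0 = 0 := by
  rw [Matrix.mem_unitaryGroup_iff, Matrix.star_eq_conjTranspose, Matrix.conjTranspose_add,
    Matrix.conjTranspose_kronecker, Matrix.conjTranspose_kronecker, mul_add, add_mul, add_mul,
    ← Matrix.mul_kronecker_mul, ← Matrix.mul_kronecker_mul, ← Matrix.mul_kronecker_mul,
    ← Matrix.mul_kronecker_mul] at h
  have h11 : (B * B.conjTranspose) 1 1 • (D * D.conjTranspose) = 1 := by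
    ext x y
    have := congrFun (congrFun h (1, x)) (1, y)
    rw [← Matrix.one_kronecker_one] at this
    simpa [Matrix.kroneckerMap_apply, diagOp] using this
  have h01 : (l * star (B 1 0)) • (C * D.conjTranspose) +
      (B * B.conjTranspose) 0 1 • (D * D.conjTranspose) = 0 := by
    ext x y
    have := congrFun (congrFun h (0, x)) (1, y)
    rw [← Matrix.one_kronecker_one] at this
    simpa [Matrix.kroneckerMap_apply, diagOp, Matrix.mul_apply, Fin.sum_univ_two] using this
  rw [← Matrix.smul_mul, ← Matrix.smul_mul, ← add_mul] at h01
  have hD : ((B * B.conjTranspose) 1 1 • D.conjTranspose) * D = 1 := by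
    rw [mul_eq_one_comm, Matrix.mul_smul, h11]
  have h0 := congrArg (fun X => X * ((B * B.conjTranspose) 1 1 • D)) h01
  simp only [zero_mul, mul_assoc] at h0
  rw [Matrix.mul_smul, ← Matrix.smul_mul, hD, mul_one] at h0
  have := (LinearIndependent.pair_iff.1 hCD _ _ h0).1
  simpa [hl] using this

theorem isDiag_of_kronecker_unitary {l : ℂ} (hl : l ≠ 0) {B : QubitOp} {C D : Matrix R R ℂ}
    (hCD : LinearIndependent ℂ ![C, D])
    (h : diagOp l 0 ⊗ₖ C + B ⊗ₖ D ∈ Matrix.unitaryGroup (Fin 2 × R) ℂ) : B.IsDiag := by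
  have h10 := kronecker_entry_eq_zero_of_unitary hl hCD h
  have hl' : star l ≠ 0 := by simpa using hl
  have hCD' : LinearIndependent ℂ ![C.conjTranspose, D.conjTranspose] := by
    rw [LinearIndependent.pair_iff] at hCD ⊢
    intro s t hst
    have := hCD (star s) (star t) (by
      rw [← Matrix.conjTranspose_inj]
      simpa using hst)
    simpa using this
  -- The other off-diagonal entry comes from the adjoint gate.
  have h01 := kronecker_entry_eq_zero_of_unitary (B := B.conjTranspose) hl' hCD' (by
    have := Unitary.star_mem h
    rw [Matrix.star_eq_conjTranspose, Matrix.conjTranspose_add,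
      Matrix.conjTranspose_kronecker, Matrix.conjTranspose_kronecker] at this
    convert this using 3
    ext i j
    fin_cases i <;> fin_cases j <;> simp [diagOp])
  rw [Matrix.conjTranspose_apply, star_eq_zero] at h01
  intro i j hij
  fin_cases i <;> fin_cases j <;> first | exact absurd rfl hij | assumption

/-- An explicit singular value decomposition in rank one: the second column of `W` spans the kernel
of `N`, its first column is orthogonal to that, and the first row of `V` is the conjugate of the
image `(p, q)` of the first column, up to normalisation. -/
theorem exists_unitary_mul_mul_eq_diagOp {N : QubitOp} (hN : N ≠ 0) (hdet : N.det = 0) :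
    ∃ V ∈ Matrix.unitaryGroup (Fin 2) ℂ, ∃ W ∈ Matrix.unitaryGroup (Fin 2) ℂ, ∃ l : ℂ, l ≠ 0 ∧
      V * N * W = diagOp l 0 := by
  have unit : ∀ p q : ℂ, (p ≠ 0 ∨ q ≠ 0) → ∃ r : ℂ, r ≠ 0 ∧ conj r = r ∧
      r * r * (p * conj p + q * conj q) = 1 := by
    intro p q hpq
    have hpos : 0 < ‖p‖ ^ 2 + ‖q‖ ^ 2 := by
      rcases hpq with h | h
      · have := norm_pos_iff.2 h
        positivity
      · have := norm_pos_iff.2 h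
        positivity
    have hs := Real.sqrt_pos.2 hpos
    refine ⟨((√(‖p‖ ^ 2 + ‖q‖ ^ 2))⁻¹ : ℝ), ?_, by simp, ?_⟩
    · exact_mod_cast (inv_pos.2 hs).ne'
    · have h1 : p * conj p + q * conj q = ((‖p‖ ^ 2 + ‖q‖ ^ 2 : ℝ) : ℂ) := by
        simp [Complex.mul_conj']
      rw [h1, ← Complex.ofReal_mul, ← Complex.ofReal_mul, ← mul_inv, Real.mul_self_sqrt hpos.le,
        inv_mul_cancel₀ hpos.ne', Complex.ofReal_one]
  obtain ⟨w, hw0, hw⟩ := Matrix.exists_mulVec_eq_zero_iff.2 hdet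
  have hw' : w 0 ≠ 0 ∨ w 1 ≠ 0 := by
    by_contra! h
    exact hw0 (funext fun i => by fin_cases i <;> simp [h])
  obtain ⟨r, hr, hrs, hr1⟩ := unit _ _ hw'
  have e0 := congrFun hw 0
  have e1 := congrFun hw 1
  simp only [Matrix.mulVec, dotProduct, Fin.sum_univ_two, Pi.zero_apply] at e0 e1
  set p := N 0 0 * -conj (w 1) + N 0 1 * conj (w 0) with hp
  set q := N 1 0 * -conj (w 1) + N 1 1 * conj (w 0) with hq
  have hpq : p ≠ 0 ∨ q ≠ 0 := by
    by_contra! h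
    have hz : ∀ i, (N i 0 * w 0 + N i 1 * w 1 = 0) → N i 0 * -conj (w 1) + N i 1 * conj (w 0) = 0 →
        N i 0 = 0 ∧ N i 1 = 0 := by
      intro i h1 h2
      constructor
      · linear_combination r * r * conj (w 0) * h1 - r * r * w 1 * h2 - N i 0 * hr1
      · linear_combination r * r * conj (w 1) * h1 + r * r * w 0 * h2 - N i 1 * hr1
    refine hN ?_
    ext i j
    have h0 := hz 0 e0 h.1
    have h1 := hz 1 e1 h.2
    fin_cases i <;> fin_cases j <;> simp [h0, h1]
  obtain ⟨s, hs, hss, hs1⟩ := unit p q hpq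
  have hpq0 : p * conj p + q * conj q ≠ 0 := fun h0 => by
    rw [h0, mul_zero] at hs1
    exact zero_ne_one hs1
  refine ⟨s • !![conj p, conj q; -q, p], ?_, r • !![-conj (w 1), w 0; conj (w 0), w 1], ?_,
    s * r * (p * conj p + q * conj q), mul_ne_zero (mul_ne_zero hs hr) hpq0, ?_⟩
  · rw [Matrix.mem_unitaryGroup_iff]
    ext i j
    fin_cases i <;> fin_cases j <;>
      simp [Matrix.mul_apply, Fin.sum_univ_two, Matrix.star_apply, hss] <;>
      first | ring1 | linear_combination hs1
  · rw [Matrix.mem_unitaryGroup_iff]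
    ext i j
    fin_cases i <;> fin_cases j <;>
      simp [Matrix.mul_apply, Fin.sum_univ_two, Matrix.star_apply, hrs] <;>
      first | ring1 | linear_combination hr1
  · have hdet' := hdet
    rw [Matrix.det_fin_two] at hdet'
    ext i j
    fin_cases i <;> fin_cases j <;>
      simp [Matrix.mul_apply, Fin.sum_univ_two, diagOp, Matrix.vecMul, dotProduct]
    · linear_combination (-s * r * conj p) * hp - s * r * conj q * hq
    · linear_combination s * r * conj p * e0 + s * r * conj q * e1
    · linear_combination s * r * q * hp - s * r * p * hq
    · linear_combination - s * r * q * e0 + s * r * p * e1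

theorem exists_isDiag_of_det_eq_zero {N B : QubitOp} (hN : N ≠ 0) (hdet : N.det = 0)
    {C D : Matrix R R ℂ} (hCD : LinearIndependent ℂ ![C, D])
    (h : N ⊗ₖ C + B ⊗ₖ D ∈ Matrix.unitaryGroup (Fin 2 × R) ℂ) :
    ∃ V ∈ Matrix.unitaryGroup (Fin 2) ℂ, ∃ W ∈ Matrix.unitaryGroup (Fin 2) ℂ,
      (V * N * W).IsDiag ∧ (V * B * W).IsDiag := by
  obtain ⟨V, hV, W, hW, l, hl, hE⟩ := exists_unitary_mul_mul_eq_diagOp hN hdet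
  have hk : ∀ {X : QubitOp}, X ∈ Matrix.unitaryGroup (Fin 2) ℂ →
      X ⊗ₖ (1 : Matrix R R ℂ) ∈ Matrix.unitaryGroup (Fin 2 × R) ℂ := by
    intro X hX
    rw [Matrix.mem_unitaryGroup_iff, Matrix.star_eq_conjTranspose,
      Matrix.conjTranspose_kronecker, ← Matrix.mul_kronecker_mul, ← Matrix.star_eq_conjTranspose,
      Matrix.mem_unitaryGroup_iff.1 hX]
    simp
  refine ⟨V, hV, W, hW, ?_, isDiag_of_kronecker_unitary hl hCD (B := V * B * W) ?_⟩
  · rw [hE]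
    exact Matrix.isDiag_diagonal _
  · have := mul_mem (mul_mem (hk hV) h) (hk hW)
    rw [mul_add, add_mul, ← Matrix.mul_kronecker_mul, ← Matrix.mul_kronecker_mul,
      ← Matrix.mul_kronecker_mul, ← Matrix.mul_kronecker_mul, hE] at this
    simpa using this

/-- When `A.det ≠ 0`, the determinant is a quadratic polynomial in `s`, which has a complex root. -/
theorem exists_det_eq_zero (A B : QubitOp) :
    A.det = 0 ∨ ∃ s : ℂ, (B + s • A).det = 0 := by
  by_cases hA : A.det = 0
  · exact Or.inl hA
  right
  set m := A 0 0 * B 1 1 + B 0 0 * A 1 1 - A 0 1 * B 1 0 - B 0 1 * A 1 0 with hm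
  obtain ⟨d, hd⟩ := IsAlgClosed.exists_eq_mul_self (discrim A.det m B.det)
  obtain ⟨s, hs⟩ := exists_quadratic_eq_zero hA ⟨d, hd⟩
  refine ⟨s, ?_⟩
  rw [← hs, hm]
  simp only [Matrix.det_fin_two, Matrix.add_apply, Matrix.smul_apply, smul_eq_mul]
  ring

theorem exists_isDiag_of_kronecker {A B : QubitOp} (hAB : LinearIndependent ℂ ![A, B])
    {C D : Matrix R R ℂ} (hCD : LinearIndependent ℂ ![C, D])
    (h : A ⊗ₖ C + B ⊗ₖ D ∈ Matrix.unitaryGroup (Fin 2 × R) ℂ) :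
    ∃ V ∈ Matrix.unitaryGroup (Fin 2) ℂ, ∃ W ∈ Matrix.unitaryGroup (Fin 2) ℂ,
      (V * A * W).IsDiag ∧ (V * B * W).IsDiag := by
  rcases exists_det_eq_zero A B with hA | ⟨s, hs⟩
  · exact exists_isDiag_of_det_eq_zero hAB.pair_left_ne_zero hA hCD h
  · have hN : B + s • A ≠ 0 := by
      intro h0
      have := (LinearIndependent.pair_iff.1 hAB s 1 (by rw [one_smul, add_comm]; exact h0)).2
      exact one_ne_zero this
    -- The sum is rewritten as `(B + s A) ⊗ D + A ⊗ (C - s D)`, so that its first local factor is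
    -- singular.
    have hCD' : LinearIndependent ℂ ![D, C - s • D] := by
      rw [LinearIndependent.pair_iff] at hCD ⊢
      intro p q hpq
      have := hCD q (p - q * s) (by rw [← hpq]; module)
      refine ⟨?_, this.1⟩
      have h2 := this.2
      rw [this.1] at h2
      simpa using h2
    have h' : (B + s • A) ⊗ₖ D + A ⊗ₖ (C - s • D) ∈ Matrix.unitaryGroup (Fin 2 × R) ℂ := by
      convert h using 1
      ext ⟨i, x⟩ ⟨j, y⟩
      simp [Matrix.kroneckerMap_apply]
      ring
    obtain ⟨V, hV, W, hW, h1, h2⟩ := exists_isDiag_of_det_eq_zero hN hs hCD' h'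
    refine ⟨V, hV, W, hW, h2, ?_⟩
    have : V * B * W = V * (B + s • A) * W + (-s) • (V * A * W) := by
      rw [mul_add, add_mul, Matrix.mul_smul, Matrix.smul_mul]
      module
    rw [this]
    exact h1.add (h2.smul _)

end Kronecker

/-! ### Genuine gates are locally equivalent to diagonal gates. -/

section Diagonalization

variable {n : ℕ}

theorem isProductAcross_singleton {U : NQubitOp n}
    (hU : U ∈ Matrix.unitaryGroup (Fin n → Fin 2) ℂ) (i : Fin n) (M : QubitOp)
    (K : Matrix ({j // j ∉ ({i} : Finset (Fin n))} → Fin 2)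
      ({j // j ∉ ({i} : Finset (Fin n))} → Fin 2) ℂ)
    (h : ∀ x y, U x y = M (x i) (y i) * K (fun j => x j.1) (fun j => y j.1)) :
    IsProductAcross U {i} := by
  let e := Equiv.piEquivPiSubtypeProd (fun j => j ∈ ({i} : Finset (Fin n))) (fun _ => Fin 2)
  let V : Matrix ({j // j ∈ ({i} : Finset (Fin n))} → Fin 2)
      ({j // j ∈ ({i} : Finset (Fin n))} → Fin 2) ℂ :=
    Matrix.of fun x y => M (x ⟨i, Finset.mem_singleton_self i⟩) (y ⟨i, Finset.mem_singleton_self i⟩)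
  have hVK : V ⊗ₖ K = U.submatrix e.symm e.symm := by
    ext p q
    have := h (e.symm p) (e.symm q)
    rw [Matrix.submatrix_apply, this]
    have hp : (fun j : {j // j ∉ ({i} : Finset (Fin n))} => e.symm p j.1) = p.2 :=
      congrArg Prod.snd (e.apply_symm_apply p)
    have hq : (fun j : {j // j ∉ ({i} : Finset (Fin n))} => e.symm q j.1) = q.2 :=
      congrArg Prod.snd (e.apply_symm_apply q)
    have hp' : e.symm p i = p.1 ⟨i, Finset.mem_singleton_self i⟩ :=
      congrFun (congrArg Prod.fst (e.apply_symm_apply p)) ⟨i, Finset.mem_singleton_self i⟩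
    have hq' : e.symm q i = q.1 ⟨i, Finset.mem_singleton_self i⟩ :=
      congrFun (congrArg Prod.fst (e.apply_symm_apply q)) ⟨i, Finset.mem_singleton_self i⟩
    rw [hp, hq, hp', hq']
    rfl
  have hu : V ⊗ₖ K ∈ Matrix.unitaryGroup _ ℂ := by
    rw [hVK, Matrix.mem_unitaryGroup_iff, Matrix.star_eq_conjTranspose,
      Matrix.conjTranspose_submatrix, Matrix.submatrix_mul_equiv, ← Matrix.star_eq_conjTranspose,
      Matrix.mem_unitaryGroup_iff.1 hU, Matrix.submatrix_one_equiv]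
  obtain ⟨c, hc, hV, hK⟩ := exists_smul_mem_unitaryGroup_of_kronecker hu
  refine ⟨_, hV, _, hK, fun x y => ?_⟩
  rw [h, Matrix.smul_apply, Matrix.smul_apply, smul_eq_mul, smul_eq_mul]
  simp only [V, Matrix.of_apply]
  field_simp

/-- The product of all factors of `prodOp A` but the one at `i`. -/
def prodOpErase (A : Fin n → QubitOp) (i : Fin n) :
    Matrix ({j // j ≠ i} → Fin 2) ({j // j ≠ i} → Fin 2) ℂ :=
  Matrix.of fun x y => ∏ j : {j // j ≠ i}, A j.1 (x j) (y j)

theorem prodOp_eq_mul_prodOpErase (A : Fin n → QubitOp) (i : Fin n) (x y : Fin n → Fin 2) :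
    prodOp A x y = A i (x i) (y i) * prodOpErase A i (fun j => x j.1) (fun j => y j.1) :=
  Fintype.prod_eq_mul_prod_subtype_ne _ i

theorem isProductAcross_singleton_of_eq_mul {U : NQubitOp n}
    (hU : U ∈ Matrix.unitaryGroup (Fin n → Fin 2) ℂ) (i : Fin n) (M : QubitOp)
    (K : Matrix ({j // j ≠ i} → Fin 2) ({j // j ≠ i} → Fin 2) ℂ)
    (h : ∀ x y, U x y = M (x i) (y i) * K (fun j => x j.1) (fun j => y j.1)) :
    IsProductAcross U {i} :=
  isProductAcross_singleton hU i M
    (Matrix.of fun x y => K (fun j => x ⟨j.1, by simpa using j.2⟩)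
      (fun j => y ⟨j.1, by simpa using j.2⟩)) h

theorem IsGenuineSR2Gate.not_isProductAcross_singleton (hn : 2 ≤ n) {U : NQubitOp n}
    (h : IsGenuineSR2Gate U) (i : Fin n) : ¬ IsProductAcross U {i} := by
  refine h.genuine {i} (Finset.singleton_nonempty i) fun h0 => ?_
  have := congrArg Finset.card h0
  simp at this
  omega

/-- If both factors at `i` are multiples of one matrix `M`, that matrix factors out and qubit `i`
splits off. -/
theorem IsGenuineSR2Gate.linearIndependent (hn : 2 ≤ n) {A B : Fin n → QubitOp}
    (h : IsGenuineSR2Gate (prodOp A + prodOp B)) (i : Fin n) :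
    LinearIndependent ℂ ![A i, B i] := by
  by_contra hi
  obtain ⟨M, s, t, hA, hB⟩ := exists_smul_of_not_linearIndependent hi
  refine h.not_isProductAcross_singleton hn i (isProductAcross_singleton_of_eq_mul h.unitary i M
    (s • prodOpErase A i + t • prodOpErase B i) fun x y => ?_)
  rw [Matrix.add_apply, prodOp_eq_mul_prodOpErase A i, prodOp_eq_mul_prodOpErase B i, hA, hB]
  simp
  ring

theorem IsGenuineSR2Gate.linearIndependent_prodOpErase (hn : 2 ≤ n) {A B : Fin n → QubitOp}
    (h : IsGenuineSR2Gate (prodOp A + prodOp B)) (i : Fin n) :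
    LinearIndependent ℂ ![prodOpErase A i, prodOpErase B i] := by
  by_contra hi
  obtain ⟨M, s, t, hA, hB⟩ := exists_smul_of_not_linearIndependent hi
  refine h.not_isProductAcross_singleton hn i (isProductAcross_singleton_of_eq_mul h.unitary i
    (s • A i + t • B i) M fun x y => ?_)
  rw [Matrix.add_apply, prodOp_eq_mul_prodOpErase A i, prodOp_eq_mul_prodOpErase B i, hA, hB]
  simp
  ring

theorem IsGenuineSR2Gate.exists_isDiag (hn : 2 ≤ n) {A B : Fin n → QubitOp}
    (h : IsGenuineSR2Gate (prodOp A + prodOp B)) (i : Fin n) :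
    ∃ V ∈ Matrix.unitaryGroup (Fin 2) ℂ, ∃ W ∈ Matrix.unitaryGroup (Fin 2) ℂ,
      (V * A i * W).IsDiag ∧ (V * B i * W).IsDiag := by
  refine exists_isDiag_of_kronecker (h.linearIndependent hn i)
    (h.linearIndependent_prodOpErase hn i) ?_
  have hk : A i ⊗ₖ prodOpErase A i + B i ⊗ₖ prodOpErase B i =
      (prodOp A + prodOp B).submatrix (Equiv.funSplitAt i (Fin 2)).symm
        (Equiv.funSplitAt i (Fin 2)).symm := by
    ext p q
    have hp := (Equiv.funSplitAt i (Fin 2)).apply_symm_apply p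
    have hq := (Equiv.funSplitAt i (Fin 2)).apply_symm_apply q
    change _ = prodOp A _ _ + prodOp B _ _
    rw [prodOp_eq_mul_prodOpErase A i, prodOp_eq_mul_prodOpErase B i]
    conv_lhs => rw [← hp, ← hq]
    rfl
  rw [hk, Matrix.mem_unitaryGroup_iff, Matrix.star_eq_conjTranspose,
    Matrix.conjTranspose_submatrix, Matrix.submatrix_mul_equiv, ← Matrix.star_eq_conjTranspose,
    Matrix.mem_unitaryGroup_iff.1 h.unitary, Matrix.submatrix_one_equiv]

theorem prodOp_diagonal (a : Fin n → Fin 2 → ℂ) :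
    prodOp (fun i => Matrix.diagonal (a i)) = Matrix.diagonal fun x => ∏ i, a i (x i) := by
  ext x y
  simp only [prodOp_apply, Matrix.diagonal_apply]
  rw [Finset.prod_ite_zero]
  simp [funext_iff]

theorem diagonal_mem_unitaryGroup_iff {ι : Type*} [Fintype ι] [DecidableEq ι] (u : ι → ℂ) :
    Matrix.diagonal u ∈ Matrix.unitaryGroup ι ℂ ↔ ∀ x, ‖u x‖ = 1 := by
  rw [Matrix.mem_unitaryGroup_iff, Matrix.star_eq_conjTranspose, Matrix.diagonal_conjTranspose,
    Matrix.diagonal_mul_diagonal, ← Matrix.diagonal_one, Matrix.diagonal_injective.eq_iff,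
    funext_iff]
  refine forall_congr' fun x => ?_
  rw [Pi.star_apply, ← starRingEnd_apply, Complex.mul_conj']
  norm_cast
  exact pow_eq_one_iff_of_nonneg (norm_nonneg _) two_ne_zero

theorem permuteQubits_refl (U : NQubitOp n) : permuteQubits (Equiv.refl _) U = U := rfl

theorem mul_ne_mul_of_linearIndependent_diagonal {a b : Fin 2 → ℂ}
    (h : LinearIndependent ℂ ![Matrix.diagonal a, Matrix.diagonal b]) :
    a 0 * b 1 ≠ a 1 * b 0 := by
  intro h0
  rw [LinearIndependent.pair_iff] at h
  have h1 : ∀ k, b k = 0 ∧ a k = 0 := by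
    intro k
    have := h (b k) (-a k) (by
      ext i j
      fin_cases k <;> fin_cases i <;> fin_cases j <;> simp [mul_comm] <;>
        first | linear_combination h0 | linear_combination -h0)
    simpa using this
  have := h 1 0 (by
    ext i j
    fin_cases i <;> fin_cases j <;> simp [h1])
  simp at this

theorem linearIndependent_diagonal {a b : Fin 2 → ℂ} (h : a 0 * b 1 ≠ a 1 * b 0) :
    LinearIndependent ℂ ![Matrix.diagonal a, Matrix.diagonal b] := by
  rw [LinearIndependent.pair_iff]
  intro s t hst
  have h0 := congrFun (congrFun hst 0) 0
  have h1 := congrFun (congrFun hst 1) 1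
  simp at h0 h1
  have h' : a 0 * b 1 - a 1 * b 0 ≠ 0 := sub_ne_zero.2 h
  constructor
  · refine (mul_eq_zero.1 ?_).resolve_right h'
    linear_combination b 1 * h0 - b 0 * h1
  · refine (mul_eq_zero.1 ?_).resolve_right h'
    linear_combination a 0 * h1 - a 1 * h0

theorem linearIndependent_mul_mul {V W : QubitOp} (hV : V ∈ Matrix.unitaryGroup (Fin 2) ℂ)
    (hW : W ∈ Matrix.unitaryGroup (Fin 2) ℂ) {A B : QubitOp} (h : LinearIndependent ℂ ![A, B]) :
    LinearIndependent ℂ ![V * A * W, V * B * W] := by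
  rw [LinearIndependent.pair_iff] at h ⊢
  intro s t hst
  refine h s t ?_
  have := congrArg (fun X => star V * X * star W) hst
  simp only [mul_add, add_mul, Matrix.mul_smul, Matrix.smul_mul, mul_zero, zero_mul] at this
  have hc : ∀ X, star V * (V * X * W) * star W = X := fun X => by
    rw [mul_assoc V, ← mul_assoc (star V), Matrix.mem_unitaryGroup_iff'.1 hV, one_mul, mul_assoc,
      Matrix.mem_unitaryGroup_iff.1 hW, mul_one]
  rwa [hc, hc] at this

/-- A genuine gate of Schmidt rank two is locally equivalent to a diagonal gate. -/
theorem IsGenuineSR2Gate.exists_diagonal (hn : 2 ≤ n) {A B : Fin n → QubitOp}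
    (h : IsGenuineSR2Gate (prodOp A + prodOp B)) :
    ∃ a b : Fin n → Fin 2 → ℂ, (∀ i, a i 0 * b i 1 ≠ a i 1 * b i 0) ∧
      (∀ x : Fin n → Fin 2, ‖∏ i, a i (x i) + ∏ i, b i (x i)‖ = 1) ∧
      PermLUEquivalent (prodOp A + prodOp B)
        (Matrix.diagonal fun x => ∏ i, a i (x i) + ∏ i, b i (x i)) := by
  choose V hV W hW hA hB using h.exists_isDiag hn
  have hperm : PermLUEquivalent (prodOp A + prodOp B) (Matrix.diagonal fun x =>
      ∏ i, (V i * A i * W i).diag (x i) + ∏ i, (V i * B i * W i).diag (x i)) := by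
    refine ⟨Equiv.refl _, V, W, hV, hW, ?_⟩
    rw [permuteQubits_refl, mul_add, add_mul, prodOp_mul, prodOp_mul, prodOp_mul, prodOp_mul,
      ← Matrix.diagonal_add, ← prodOp_diagonal, ← prodOp_diagonal]
    simp only [(hA _).diagonal_diag, (hB _).diagonal_diag]
  refine ⟨_, _, fun i => mul_ne_mul_of_linearIndependent_diagonal ?_, ?_, hperm⟩
  · rw [(hA i).diagonal_diag, (hB i).diagonal_diag]
    exact linearIndependent_mul_mul (hV i) (hW i) (h.linearIndependent hn i)
  · exact (diagonal_mem_unitaryGroup_iff _).1 (hperm.mem_unitaryGroup h.unitary)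

theorem det_mul_mul_eq_zero_iff {V W : QubitOp} (hV : V ∈ Matrix.unitaryGroup (Fin 2) ℂ)
    (hW : W ∈ Matrix.unitaryGroup (Fin 2) ℂ) (A : QubitOp) :
    (V * A * W).det = 0 ↔ A.det = 0 := by
  have hd : ∀ {X : QubitOp}, X ∈ Matrix.unitaryGroup (Fin 2) ℂ → X.det ≠ 0 := fun hX h0 => by
    have := congrArg Matrix.det (Matrix.mem_unitaryGroup_iff.1 hX)
    rw [Matrix.det_mul, h0, zero_mul, Matrix.det_one] at this
    exact zero_ne_one this
  rw [Matrix.det_mul, Matrix.det_mul]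
  simp [hd hV, hd hW]

/-- Local unitaries and qubit permutations carry a decomposition with independent factors to another
one with the same number of singular factors. -/
theorem mem_genuineSR2Class_of_permLUEquivalent (hn : 2 ≤ n) {U : NQubitOp n}
    {A : Fin 2 → Fin n → QubitOp} (hA : ∀ i, LinearIndependent ℂ ![A 0 i, A 1 i])
    (hunit : prodOp (A 0) + prodOp (A 1) ∈ Matrix.unitaryGroup (Fin n → Fin 2) ℂ)
    (h : PermLUEquivalent U (prodOp (A 0) + prodOp (A 1))) :
    U ∈ genuineSR2Class n (singularCount A) := by
  have hU := h.symm.mem_unitaryGroup hunit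
  obtain ⟨σ, V, W, hV, hW, rfl⟩ := h.symm
  set A' : Fin 2 → Fin n → QubitOp := fun j i => V i * A j (σ.symm i) * W i with hA'
  have heq : prodOp V * permuteQubits σ (prodOp (A 0) + prodOp (A 1)) * prodOp W =
      prodOp (A' 0) + prodOp (A' 1) := by
    rw [permuteQubits_add, permuteQubits_prodOp, permuteQubits_prodOp, mul_add, add_mul,
      prodOp_mul, prodOp_mul, prodOp_mul, prodOp_mul]
  rw [heq] at hU ⊢
  have hind : ∀ i, LinearIndependent ℂ ![A' 0 i, A' 1 i] := fun i =>
    linearIndependent_mul_mul (hV i) (hW i) (hA _)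
  refine ⟨isGenuineSR2Gate_of_linearIndependent hn hind hU, A',
    ⟨schmidtRank_eq_two hn hind, by rw [Fin.sum_univ_two]⟩, ?_⟩
  rw [singularCount_eq, singularCount_eq]
  have hc : ∀ j, {i | (A' j i).det = 0}.ncard = {i | (A j i).det = 0}.ncard := by
    intro j
    rw [← Set.ncard_image_of_injective {i | (A j i).det = 0} σ.injective]
    congr 1
    ext i
    simp only [hA', Set.mem_ofPred_eq, det_mul_mul_eq_zero_iff (hV i) (hW i), Set.mem_image]
    constructor
    · intro h0
      exact ⟨σ.symm i, h0, σ.apply_symm_apply i⟩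
    · rintro ⟨k, hk, rfl⟩
      rwa [σ.symm_apply_apply]
  rw [hc, hc]

end Diagonalization

/-! ### Permutations, phases and bit flips acting on diagonal gates. -/

section DiagonalEquivalence

variable {n : ℕ}

theorem permLUEquivalent_diagonal_perm (σ : Equiv.Perm (Fin n)) (u : (Fin n → Fin 2) → ℂ) :
    PermLUEquivalent (Matrix.diagonal u) (Matrix.diagonal fun x => u (x ∘ σ)) := by
  refine ⟨σ, fun _ => 1, fun _ => 1, fun _ => one_mem _, fun _ => one_mem _, ?_⟩
  rw [prodOp_one, one_mul, mul_one]
  exact (Matrix.submatrix_diagonal_equiv u (bitPerm σ)).symm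

theorem permLUEquivalent_diagonal_phase {φ : Fin n → Fin 2 → ℂ} (hφ : ∀ i s, ‖φ i s‖ = 1)
    (u : (Fin n → Fin 2) → ℂ) :
    PermLUEquivalent (Matrix.diagonal u) (Matrix.diagonal fun x => (∏ i, φ i (x i)) * u x) := by
  refine ⟨Equiv.refl _, fun i => Matrix.diagonal (φ i), fun _ => 1,
    fun i => (diagonal_mem_unitaryGroup_iff _).2 (hφ i), fun _ => one_mem _, ?_⟩
  rw [prodOp_one, mul_one, permuteQubits_refl, prodOp_diagonal, Matrix.diagonal_mul_diagonal]

theorem permLUEquivalent_diagonal_flip (τ : Fin n → Equiv.Perm (Fin 2))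
    (u : (Fin n → Fin 2) → ℂ) :
    PermLUEquivalent (Matrix.diagonal u) (Matrix.diagonal fun x => u fun i => τ i (x i)) := by
  have hV : ∀ i, (1 : QubitOp).submatrix (τ i) id ∈ Matrix.unitaryGroup (Fin 2) ℂ := by
    intro i
    rw [Matrix.mem_unitaryGroup_iff, Matrix.star_eq_conjTranspose,
      Matrix.conjTranspose_submatrix, Matrix.conjTranspose_one,
      ← Matrix.submatrix_mul _ _ _ _ _ Function.bijective_id, one_mul,
      Matrix.submatrix_one_equiv]
  have hW : ∀ i, (1 : QubitOp).submatrix id (τ i) ∈ Matrix.unitaryGroup (Fin 2) ℂ := by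
    intro i
    have := Unitary.star_mem (hV i)
    rwa [Matrix.star_eq_conjTranspose, Matrix.conjTranspose_submatrix,
      Matrix.conjTranspose_one] at this
  refine ⟨Equiv.refl _, _, _, hV, hW, ?_⟩
  rw [permuteQubits_refl]
  let e := Equiv.piCongrRight τ
  have h1 : prodOp (fun i => (1 : QubitOp).submatrix (τ i) id) =
      (1 : NQubitOp n).submatrix e id := by
    rw [← prodOp_one]
    rfl
  have h2 : prodOp (fun i => (1 : QubitOp).submatrix id (τ i)) =
      (1 : NQubitOp n).submatrix id e := by
    rw [← prodOp_one]
    rfl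
  rw [h1, h2, ← Matrix.submatrix_id_id (Matrix.diagonal u),
    ← Matrix.submatrix_mul _ _ _ _ _ Function.bijective_id,
    ← Matrix.submatrix_mul _ _ _ _ _ Function.bijective_id, one_mul, mul_one]
  exact (Matrix.submatrix_diagonal_equiv u e).symm

end DiagonalEquivalence

/-! ### The reduced form and the five families written in it. -/

section Reduced

variable {m : ℕ}

/-- The diagonal operator `diag d ⊗ I ⊗ ⋯ ⊗ I + diag c ⊗ diag (w 0) ⊗ ⋯ ⊗ diag (w (m - 1))`. -/
noncomputable def reducedOp (d c : Fin 2 → ℂ) (w : Fin m → Fin 2 → ℂ) : NQubitOp (m + 1) :=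
  Matrix.diagonal fun x => d (x 0) + c (x 0) * ∏ j, w j (x j.succ)

theorem prodOp_diagonal_cons (c : Fin 2 → ℂ) (w : Fin m → Fin 2 → ℂ) :
    prodOp (fun i => Matrix.diagonal ((Fin.cons c w : Fin (m + 1) → Fin 2 → ℂ) i)) =
      Matrix.diagonal fun x => c (x 0) * ∏ j, w j (x j.succ) := by
  rw [prodOp_diagonal]
  simp [Fin.prod_univ_succ]

theorem reducedOp_eq (d c : Fin 2 → ℂ) (w : Fin m → Fin 2 → ℂ) :
    reducedOp d c w =
      prodOp (fun i => Matrix.diagonal ((Fin.cons d fun _ _ => 1 : Fin (m + 1) → Fin 2 → ℂ) i)) +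
      prodOp (fun i => Matrix.diagonal ((Fin.cons c w : Fin (m + 1) → Fin 2 → ℂ) i)) := by
  rw [prodOp_diagonal_cons, prodOp_diagonal_cons, Matrix.diagonal_add, reducedOp]
  simp

theorem Set.ncard_fin_succ (p : Fin (m + 1) → Prop) [DecidablePred p] :
    {i | p i}.ncard = (if p 0 then 1 else 0) + {j : Fin m | p j.succ}.ncard := by
  rw [Set.ncard_eq_toFinset_card', Set.ncard_eq_toFinset_card']
  simp only [Set.toFinset_ofPred]
  rw [Fin.card_filter_univ_succ]
  split_ifs <;> omega

-- The common criterion behind the five membership proofs: the identity factors are never singular,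
-- so the count sees only `d`, `c` and `w`.
open scoped Classical in
theorem mem_genuineSR2Class_of_reducedOp (hm : 1 ≤ m) {d c : Fin 2 → ℂ} {w : Fin m → Fin 2 → ℂ}
    (hdc : d 0 * c 1 ≠ d 1 * c 0) (hw : ∀ j, w j 0 ≠ w j 1)
    (hunit : ∀ x : Fin (m + 1) → Fin 2, ‖d (x 0) + c (x 0) * ∏ j, w j (x j.succ)‖ = 1)
    {U : NQubitOp (m + 1)} (h : PermLUEquivalent U (reducedOp d c w)) {k : ℕ}
    (hk : (if d 0 * d 1 = 0 then 1 else 0) + (if c 0 * c 1 = 0 then 1 else 0) +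
      {j | w j 0 * w j 1 = 0}.ncard = k) :
    U ∈ genuineSR2Class (m + 1) k := by
  let A : Fin 2 → Fin (m + 1) → QubitOp :=
    ![fun i => Matrix.diagonal ((Fin.cons d fun _ _ => 1 : Fin (m + 1) → Fin 2 → ℂ) i),
      fun i => Matrix.diagonal ((Fin.cons c w : Fin (m + 1) → Fin 2 → ℂ) i)]
  have hA : reducedOp d c w = prodOp (A 0) + prodOp (A 1) := reducedOp_eq d c w
  have hcount : singularCount A = k := by
    rw [singularCount_eq, Set.ncard_fin_succ, Set.ncard_fin_succ, ← hk]
    simp only [A, Matrix.cons_val_zero, Matrix.cons_val_one, Matrix.det_diagonal,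
      Fin.prod_univ_two, Fin.cons_zero, Fin.cons_succ]
    have : {j : Fin m | (1 : ℂ) * 1 = 0} = ∅ := by simp
    rw [this, Set.ncard_empty]
    omega
  rw [← hcount]
  refine mem_genuineSR2Class_of_permLUEquivalent (by omega) ?_ ?_ (hA ▸ h)
  · intro i
    refine linearIndependent_diagonal ?_
    refine Fin.cases ?_ (fun j => ?_) i
    · simpa using hdc
    · simpa using (hw j).symm
  · rw [← hA]
    exact (diagonal_mem_unitaryGroup_iff _).2 hunit

theorem formAll_eq (θ : ℝ) : formAll (m + 1) θ =
    reducedOp ![1, 1] ![Complex.exp (Complex.I * θ) - 1, 0] fun _ : Fin m => ![1, 0] := by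
  have h0 : prodOp (fun _ : Fin (m + 1) => ketbra0) =
      Matrix.diagonal fun x => ![1, 0] (x 0) * ∏ j : Fin m, ![1, 0] (x j.succ) := by
    rw [← prodOp_diagonal_cons ![1, 0] fun _ : Fin m => ![1, 0]]
    congr 1
    ext1 i
    refine Fin.cases ?_ (fun j => ?_) i <;> rfl
  rw [formAll, prodOp_one, h0, ← Matrix.diagonal_one, ← Matrix.diagonal_smul,
    Matrix.diagonal_add, reducedOp]
  congr 1
  ext1 x
  simp only [Pi.smul_apply, smul_eq_mul, ← mul_assoc]
  generalize x 0 = s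
  fin_cases s <;> simp

theorem firstRest_diagonal (a : Fin 2 → ℂ) (b : Fin (m + 1) → Fin 2 → ℂ) :
    firstRest (Matrix.diagonal a) (fun i => Matrix.diagonal (b i)) =
      Matrix.diagonal fun x => a (x 0) * ∏ j : Fin m, b j.succ (x j.succ) := by
  rw [← prodOp_diagonal_cons a fun j => b j.succ]
  refine congrArg prodOp (funext fun i => ?_)
  refine Fin.cases ?_ (fun j => ?_) i
  · simp
  · simp

theorem firstRest_diagonal_one (a : Fin 2 → ℂ) :
    firstRest (Matrix.diagonal a) (fun _ : Fin (m + 1) => 1) =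
      Matrix.diagonal fun x => a (x 0) := by
  simpa using firstRest_diagonal a fun _ : Fin (m + 1) => fun _ => (1 : ℂ)

theorem formTwo_eq (β : Fin (m + 1) → ℝ) : formTwo (m + 1) β =
    reducedOp ![1, 0] ![0, 1] fun j => ![1, Complex.exp (Complex.I * β j.succ)] := by
  rw [formTwo]
  simp only [ketbra0, ketbra1, diagOp]
  rw [firstRest_diagonal_one, firstRest_diagonal, Matrix.diagonal_add, reducedOp]

theorem formOne_eq (α : ℝ) : formOne (m + 1) α =
    reducedOp ![(Real.sin α : ℂ), 1] ![Complex.I * (Real.cos α : ℂ), 0]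
      fun _ : Fin m => ![1, -1] := by
  rw [formOne]
  simp only [ketbra0, sigma3, diagOp]
  rw [firstRest_diagonal_one, firstRest_diagonal, ← Matrix.diagonal_smul, Matrix.diagonal_add,
    reducedOp]
  congr 1
  ext1 x
  simp only [Pi.smul_apply, smul_eq_mul, ← mul_assoc]
  generalize x 0 = s
  fin_cases s <;> simp [add_comm]

theorem formZero_eq (α β : ℝ) : formZero (m + 1) α β =
    reducedOp ![(Real.cos α : ℂ), (Real.cos β : ℂ)]
      ![Complex.I * (Real.sin α : ℂ), Complex.I * (Real.sin β : ℂ)]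
      fun _ : Fin m => ![1, -1] := by
  rw [formZero]
  simp only [sigma3, diagOp]
  rw [firstRest_diagonal_one, firstRest_diagonal, ← Matrix.diagonal_smul, Matrix.diagonal_add,
    reducedOp]
  congr 1
  ext1 x
  simp only [Pi.smul_apply, smul_eq_mul, ← mul_assoc]
  generalize x 0 = s
  fin_cases s <;> simp

theorem formAllButOne_eq_diagonal (θ φ : ℝ) : formAllButOne (m + 1) θ φ =
    Matrix.diagonal fun x => 1 + (∏ j : Fin m, ![1, 0] (x j.castSucc)) *
      ![Complex.exp (Complex.I * θ) - 1, Complex.exp (Complex.I * φ) - 1] (x (Fin.last m)) := by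
  have h : ∀ e : Fin 2 → ℂ, restLast (n := m + 1) ketbra0 (Matrix.diagonal e) =
      Matrix.diagonal fun x => (∏ j : Fin m, ![1, 0] (x j.castSucc)) * e (x (Fin.last m)) := by
    intro e
    have : restLast (n := m + 1) ketbra0 (Matrix.diagonal e) = prodOp fun i => Matrix.diagonal
        ((Fin.snoc (fun _ => ![1, 0]) e : Fin (m + 1) → Fin 2 → ℂ) i) := by
      refine congrArg prodOp (funext fun i => ?_)
      refine Fin.lastCases ?_ (fun j => ?_) i
      · simp
      · simp [ketbra0, diagOp, j.isLt.ne]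
    rw [this, prodOp_diagonal]
    simp [Fin.prod_univ_castSucc]
  rw [formAllButOne, prodOp_one]
  simp only [diagOp]
  rw [h, ← Matrix.diagonal_one, Matrix.diagonal_add]

end Reduced

/-! ### Each family lies in the class of its singular number. -/

section Forms

variable {m : ℕ}

theorem permLUEquivalent_formAllButOne (θ φ : ℝ) :
    PermLUEquivalent (formAllButOne (m + 1) θ φ) (reducedOp ![1, 1]
      ![Complex.exp (Complex.I * θ) - 1, Complex.exp (Complex.I * φ) - 1]
      fun _ : Fin m => ![1, 0]) := by
  rw [formAllButOne_eq_diagonal]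
  -- The family has its distinguished qubit last and `reducedOp` has it first; a cyclic rotation
  -- moves it.
  have h := permLUEquivalent_diagonal_perm (finRotate (m + 1)) fun x : Fin (m + 1) → Fin 2 =>
    1 + (∏ j : Fin m, ![1, 0] (x j.castSucc)) *
      ![Complex.exp (Complex.I * θ) - 1, Complex.exp (Complex.I * φ) - 1] (x (Fin.last m))
  convert h using 1
  rw [reducedOp]
  congr 1
  ext1 x
  simp only [Function.comp_apply, finRotate_last]
  have h1 : ∀ j : Fin m, finRotate (m + 1) j.castSucc = j.succ := fun j => by
    rw [finRotate_apply, Fin.coeSucc_eq_succ]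
  simp only [h1, mul_comm]
  congr 1
  generalize x 0 = s
  fin_cases s <;> rfl

theorem exp_ne_one_of_mem_Ioo {θ : ℝ} (h : θ ∈ Set.Ioo 0 (2 * Real.pi)) :
    Complex.exp (Complex.I * θ) ≠ 1 := by
  intro h0
  obtain ⟨k, hk⟩ := Complex.exp_eq_one_iff.1 h0
  have h1 : θ = k * (2 * Real.pi) := by
    have := congrArg Complex.im hk
    simpa using this
  have hpi := Real.pi_pos
  have h2 : (0 : ℝ) < k := by
    by_contra! hk0
    have := mul_nonpos_of_nonpos_of_nonneg hk0 (by positivity : 0 ≤ 2 * Real.pi)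
    linarith [h.1]
  have h3 : (k : ℝ) < 1 := by
    by_contra! hk1
    have := mul_le_mul_of_nonneg_right hk1 (by positivity : 0 ≤ 2 * Real.pi)
    linarith [h.2]
  norm_cast at h2 h3
  omega

theorem exp_injOn_Ioo {θ φ : ℝ} (hθ : θ ∈ Set.Ioo 0 (2 * Real.pi))
    (hφ : φ ∈ Set.Ioo 0 (2 * Real.pi))
    (h : Complex.exp (Complex.I * θ) = Complex.exp (Complex.I * φ)) : θ = φ := by
  wlog hle : φ ≤ θ generalizing θ φ
  · exact (this hφ hθ h.symm (le_of_not_ge hle)).symm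
  by_contra hne
  refine exp_ne_one_of_mem_Ioo (θ := θ - φ)
    ⟨sub_pos.2 (lt_of_le_of_ne hle (Ne.symm hne)), by linarith [hθ.2, hφ.1]⟩ ?_
  rw [Complex.ofReal_sub, mul_sub, Complex.exp_sub, h, div_self (Complex.exp_ne_zero _)]

theorem prod_bits_eq (x : Fin m → Fin 2) (w : Fin m → Fin 2 → ℂ) (p : ℂ → Prop) (h1 : p 1)
    (hmul : ∀ a b, p a → p b → p (a * b)) (hw : ∀ j s, p (w j s)) : p (∏ j, w j (x j)) :=
  Finset.prod_induction _ p hmul h1 fun j _ => hw j _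

theorem prod_zero_one (x : Fin m → Fin 2) :
    ∏ j, (![1, 0] : Fin 2 → ℂ) (x j) = 0 ∨ ∏ j, (![1, 0] : Fin 2 → ℂ) (x j) = 1 :=
  prod_bits_eq x (fun _ => ![1, 0]) (fun z => z = 0 ∨ z = 1) (Or.inr rfl)
    (by rintro _ _ (rfl | rfl) (rfl | rfl) <;> simp) (fun _ s => by fin_cases s <;> simp)

theorem prod_one_neg_one (x : Fin m → Fin 2) :
    ∏ j, (![1, -1] : Fin 2 → ℂ) (x j) = 1 ∨ ∏ j, (![1, -1] : Fin 2 → ℂ) (x j) = -1 :=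
  prod_bits_eq x (fun _ => ![1, -1]) (fun z => z = 1 ∨ z = -1) (Or.inl rfl)
    (by rintro _ _ (rfl | rfl) (rfl | rfl) <;> simp) (fun _ s => by fin_cases s <;> simp)

theorem norm_ofReal_add_I_mul {p q : ℝ} (h : p ^ 2 + q ^ 2 = 1) :
    ‖(p : ℂ) + Complex.I * q‖ = 1 := by
  rw [mul_comm, Complex.norm_add_mul_I, h, Real.sqrt_one]

theorem norm_ofReal_sub_I_mul {p q : ℝ} (h : p ^ 2 + q ^ 2 = 1) :
    ‖(p : ℂ) + -(Complex.I * q)‖ = 1 := by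
  have := norm_ofReal_add_I_mul (p := p) (q := -q) (by rw [neg_sq, h])
  rwa [Complex.ofReal_neg, mul_neg] at this

theorem mem_class_of_formAll (hm : 1 ≤ m) {U : NQubitOp (m + 1)} {θ : ℝ}
    (hθ : θ ∈ Set.Ioo 0 (2 * Real.pi)) (h : PermLUEquivalent U (formAll (m + 1) θ)) :
    U ∈ genuineSR2Class (m + 1) (m + 1) := by
  rw [formAll_eq] at h
  have h1 := sub_ne_zero.2 (exp_ne_one_of_mem_Ioo hθ)
  refine mem_genuineSR2Class_of_reducedOp hm ?_ (by simp) (fun x => ?_) h ?_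
  · simpa using h1.symm
  · rcases prod_zero_one fun j => x (Fin.succ j) with h | h <;> rw [h] <;> generalize x 0 = s <;>
      fin_cases s <;> simp
  · simp [Set.ncard_univ, add_comm]

theorem mem_class_of_formAllButOne (hm : 1 ≤ m) {U : NQubitOp (m + 1)} {θ φ : ℝ}
    (hθ : θ ∈ Set.Ioo 0 (2 * Real.pi)) (hφ : φ ∈ Set.Ioo 0 (2 * Real.pi)) (hne : θ ≠ φ)
    (h : PermLUEquivalent U (formAllButOne (m + 1) θ φ)) :
    U ∈ genuineSR2Class (m + 1) m := by
  have h := h.trans (permLUEquivalent_formAllButOne θ φ)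
  have h1 := sub_ne_zero.2 (exp_ne_one_of_mem_Ioo hθ)
  have h2 := sub_ne_zero.2 (exp_ne_one_of_mem_Ioo hφ)
  refine mem_genuineSR2Class_of_reducedOp hm ?_ (by simp) (fun x => ?_) h ?_
  · simpa using fun h0 => hne (exp_injOn_Ioo hθ hφ h0.symm)
  · rcases prod_zero_one fun j => x (Fin.succ j) with h | h <;> rw [h] <;> generalize x 0 = s <;>
      fin_cases s <;> simp
  · simp [Set.ncard_univ, h1, h2]

theorem mem_class_of_formTwo (hm : 1 ≤ m) {U : NQubitOp (m + 1)} {β : Fin (m + 1) → ℝ}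
    (hβ : ∀ i : Fin (m + 1), (i : ℕ) ≠ 0 → β i ∈ Set.Ioo 0 (2 * Real.pi))
    (h : PermLUEquivalent U (formTwo (m + 1) β)) :
    U ∈ genuineSR2Class (m + 1) 2 := by
  rw [formTwo_eq] at h
  refine mem_genuineSR2Class_of_reducedOp hm (by simp) (fun j => ?_) (fun x => ?_) h ?_
  · simpa using (exp_ne_one_of_mem_Ioo (hβ j.succ (by simp))).symm
  · have := prod_bits_eq (fun j => x (Fin.succ j))
      (fun j : Fin m => ![1, Complex.exp (Complex.I * β j.succ)]) (fun z => ‖z‖ = 1) norm_one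
      (fun a b ha hb => by rw [norm_mul, ha, hb, one_mul])
      (fun j s => by fin_cases s <;> simp)
    generalize x 0 = s
    fin_cases s
    · simp
    · simpa using this
  · simp

theorem mem_class_of_formOne (hm : 1 ≤ m) {U : NQubitOp (m + 1)} {α : ℝ}
    (hα : α ∈ Set.Ioo 0 (Real.pi / 2) ∪ Set.Ioo (Real.pi / 2) Real.pi)
    (h : PermLUEquivalent U (formOne (m + 1) α)) :
    U ∈ genuineSR2Class (m + 1) 1 := by
  rw [formOne_eq] at h
  have hpi := Real.pi_pos
  have hs : (Real.sin α : ℂ) ≠ 0 := by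
    refine Complex.ofReal_ne_zero.2 (Real.sin_pos_of_pos_of_lt_pi ?_ ?_).ne' <;>
      rcases hα with h | h <;> linarith [h.1, h.2]
  have hc : (Real.cos α : ℂ) ≠ 0 := by
    refine Complex.ofReal_ne_zero.2 ?_
    rcases hα with h | h
    · exact (Real.cos_pos_of_mem_Ioo ⟨by linarith [h.1], h.2⟩).ne'
    · exact (Real.cos_neg_of_pi_div_two_lt_of_lt h.1 (by linarith [h.2])).ne
  refine mem_genuineSR2Class_of_reducedOp hm ?_ ?_ (fun x => ?_) h ?_
  · simp only [Matrix.cons_val_zero, Matrix.cons_val_one, mul_zero, one_mul]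
    exact (mul_ne_zero Complex.I_ne_zero hc).symm
  · intro j
    simp only [Matrix.cons_val_zero, Matrix.cons_val_one]
    norm_num
  · have hsc := Real.sin_sq_add_cos_sq α
    have h1 := norm_ofReal_add_I_mul hsc
    have h2 := norm_ofReal_sub_I_mul hsc
    rcases prod_one_neg_one fun j => x (Fin.succ j) with h | h <;> rw [h] <;>
      generalize x 0 = s <;> fin_cases s <;>
      simp only [Fin.zero_eta, Fin.mk_one, Matrix.cons_val_zero, Matrix.cons_val_one, mul_one,
        mul_neg, neg_zero, add_zero, norm_one, h1, h2]
  · simp only [Matrix.cons_val_zero, Matrix.cons_val_one]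
    simp [-Complex.ofReal_sin, hs]

theorem mem_class_of_formZero (hm : 1 ≤ m) {U : NQubitOp (m + 1)} {α β : ℝ}
    (hα : α ∈ nonQuarterAngles) (hβ : β ∈ nonQuarterAngles) (hαβ : Real.sin (α - β) ≠ 0)
    (h : PermLUEquivalent U (formZero (m + 1) α β)) :
    U ∈ genuineSR2Class (m + 1) 0 := by
  rw [formZero_eq] at h
  have key : ∀ {γ : ℝ}, γ ∈ nonQuarterAngles → (Real.cos γ : ℂ) ≠ 0 ∧ (Real.sin γ : ℂ) ≠ 0 := by
    intro γ hγ
    -- On `[0, 2π)` the zeros of `sin (2γ)` are exactly the four excluded angles, so this handles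
    -- sine and cosine together.
    have h2 : Real.sin (2 * γ) ≠ 0 := by
      intro h0
      obtain ⟨k, hk⟩ := Real.sin_eq_zero_iff.1 h0
      have hpi := Real.pi_pos
      have hk0 : 0 ≤ k := by
        by_contra! hlt
        have : (k : ℝ) * Real.pi < 0 := mul_neg_of_neg_of_pos (by exact_mod_cast hlt) hpi
        linarith [hγ.1.1]
      have hk4 : k < 4 := by
        by_contra! hle
        have : (4 : ℝ) * Real.pi ≤ k * Real.pi :=
          mul_le_mul_of_nonneg_right (by exact_mod_cast hle) hpi.le
        linarith [hγ.1.2]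
      lift k to ℕ using hk0
      refine hγ.2 ⟨k, by omega⟩ ?_
      push_cast at hk
      simp only
      linarith
    rw [Real.sin_two_mul] at h2
    constructor <;> refine Complex.ofReal_ne_zero.2 fun h0 => h2 (by rw [h0]; ring)
  obtain ⟨hα1, hα2⟩ := key hα
  obtain ⟨hβ1, hβ2⟩ := key hβ
  refine mem_genuineSR2Class_of_reducedOp hm ?_ ?_ (fun x => ?_) h ?_
  · simp only [Matrix.cons_val_zero, Matrix.cons_val_one]
    intro h0
    have h1 : Complex.I * ((Real.cos α * Real.sin β - Real.cos β * Real.sin α : ℝ) : ℂ) = 0 := by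
      rw [Complex.ofReal_sub, Complex.ofReal_mul, Complex.ofReal_mul]
      linear_combination h0
    have h2 := Complex.ofReal_eq_zero.1 ((mul_eq_zero.1 h1).resolve_left Complex.I_ne_zero)
    refine hαβ ?_
    rw [Real.sin_sub]
    linarith
  · intro j
    simp only [Matrix.cons_val_zero, Matrix.cons_val_one]
    norm_num
  · have h1 := fun γ => norm_ofReal_add_I_mul (Real.cos_sq_add_sin_sq γ)
    have h2 := fun γ => norm_ofReal_sub_I_mul (Real.cos_sq_add_sin_sq γ)
    rcases prod_one_neg_one fun j => x (Fin.succ j) with h | h <;> rw [h] <;>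
      generalize x 0 = s <;> fin_cases s <;>
      simp only [Fin.zero_eta, Fin.mk_one, Matrix.cons_val_zero, Matrix.cons_val_one, mul_one,
        mul_neg, h1, h2]
  · simp only [Matrix.cons_val_zero, Matrix.cons_val_one]
    simp [-Complex.ofReal_sin, -Complex.ofReal_cos, hα1, hα2, hβ1, hβ2]

end Forms

/-! ### Reduction of a diagonal gate to the reduced form. -/

section Reduction

variable {n : ℕ}

theorem exists_fin_notMem (s : Finset (Fin n)) (hs : s.card < n) : ∃ l, l ∉ s := by
  obtain ⟨l, -, hl⟩ := Finset.exists_mem_notMem_of_card_lt_card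
    (show s.card < (Finset.univ : Finset (Fin n)).card by simpa using hs)
  exact ⟨l, hl⟩

/-- This is `|∏ a + ∏ b|² = 1` expanded and paired with the product functional `f`; each of the five
terms is a product vector, so its pairing factors over the sites. -/
theorem prod_sum_add_eq_of_norm_eq_one {a b : Fin n → Fin 2 → ℂ}
    (h : ∀ x : Fin n → Fin 2, ‖∏ i, a i (x i) + ∏ i, b i (x i)‖ = 1) (f : Fin n → Fin 2 → ℂ) :
    ∏ i, ∑ s, f i s * (a i s * conj (a i s)) + ∏ i, ∑ s, f i s * (b i s * conj (b i s)) +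
      ∏ i, ∑ s, f i s * (a i s * conj (b i s)) + ∏ i, ∑ s, f i s * (conj (a i s) * b i s) =
      ∏ i, ∑ s, f i s * 1 := by
  simp only [Finset.prod_univ_sum, Fintype.piFinset_univ, ← Finset.sum_add_distrib]
  refine Finset.sum_congr rfl fun x _ => ?_
  have hx : (∏ i, a i (x i) + ∏ i, b i (x i)) * conj (∏ i, a i (x i) + ∏ i, b i (x i)) = 1 := by
    rw [Complex.mul_conj', h]
    simp
  rw [map_add, map_prod, map_prod] at hx
  simp only [Finset.prod_mul_distrib, mul_one]
  linear_combination (∏ i, f i (x i)) * hx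

/-- A linear functional on `Fin 2 → ℂ` with kernel spanned by `v`. -/
def annihilator (v : Fin 2 → ℂ) : Fin 2 → ℂ := ![v 1, -v 0]

theorem sum_annihilator_mul (v w : Fin 2 → ℂ) :
    ∑ s, annihilator v s * w s = v 1 * w 0 - v 0 * w 1 := by
  simp [annihilator, Fin.sum_univ_two, sub_eq_add_neg]

theorem norm_eq_norm_of_mul_conj_eq {z w : ℂ} (h : z * conj z = w * conj w) : ‖z‖ = ‖w‖ := by
  rw [Complex.mul_conj', Complex.mul_conj'] at h
  norm_cast at h
  exact (pow_left_inj₀ (norm_nonneg _) (norm_nonneg _) two_ne_zero).1 h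

theorem conj_sub_ne_zero {a b : Fin 2 → ℂ} (h : a 0 * b 1 ≠ a 1 * b 0) :
    conj (a 0) * conj (b 1) - conj (a 1) * conj (b 0) ≠ 0 := by
  intro h0
  have := congrArg conj h0
  simp only [map_sub, map_mul, Complex.conj_conj, map_zero] at this
  exact h (sub_eq_zero.1 this)

/-- If a product of pairings with `b conj b` vanishes for functionals that annihilate constants at
`j`, the mixed terms at `l` and `l'`, and some linearly independent vector at further places, then
`b j` has constant modulus. -/
theorem norm_eq_norm_of_prod_annihilator_eq_zero {a b : Fin n → Fin 2 → ℂ}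
    (hb : ∀ i s, b i s ≠ 0) (hab : ∀ i, a i 0 * b i 1 ≠ a i 1 * b i 0) {f : Fin n → Fin 2 → ℂ}
    {j l l' : Fin n} (hj : f j = annihilator fun _ => 1)
    (hl : f l = annihilator fun s => a l s * conj (b l s))
    (hl' : f l' = annihilator fun s => conj (a l' s) * b l' s)
    (hf : ∀ i, i ≠ j → i ≠ l → i ≠ l' → ∑ s, f i s * (b i s * conj (b i s)) ≠ 0)
    (h0 : ∏ i, ∑ s, f i s * (b i s * conj (b i s)) = 0) : ‖b j 0‖ = ‖b j 1‖ := by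
  have hb' : ∀ i s, conj (b i s) ≠ 0 := fun i s => by simpa using hb i s
  -- Some factor vanishes. Independence of `a` and `b` excludes `l` and `l'`, so it is the one at
  -- `j`, which says that `|b j|²` is constant.
  obtain ⟨i, -, hi⟩ := Finset.prod_eq_zero_iff.1 h0
  by_cases hij : i = j
  · rw [hij, hj, sum_annihilator_mul] at hi
    exact norm_eq_norm_of_mul_conj_eq (by linear_combination hi)
  by_cases hil : i = l
  · rw [hil, hl, sum_annihilator_mul] at hi
    exfalso
    refine mul_ne_zero (mul_ne_zero (hb' l 0) (hb' l 1)) (sub_ne_zero.2 (hab l).symm) ?_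
    linear_combination hi
  by_cases hil' : i = l'
  · rw [hil', hl', sum_annihilator_mul] at hi
    exfalso
    refine mul_ne_zero (mul_ne_zero (hb l' 0) (hb l' 1)) (conj_sub_ne_zero (hab l')) ?_
    linear_combination -hi
  exact absurd hi (hf i hij hil hil')

/-- If `|a k|²` and `|b k|²` are not proportional at some `k`, then for `j ≠ k` a functional killing
the constant at `j`, `|a|²` at `k` and the mixed terms at two further sites isolates `∏ |b|²`; the
four sites are distinct, whence `4 ≤ n`. If they are proportional at every site, `∏ |a|²` is a
positive multiple `T` of `∏ |b|²`, and the two terms merge into one with coefficient `1 + T ≠ 0`. -/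
theorem exists_forall_ne_norm_eq_of_ne_zero (hn : 4 ≤ n) {a b : Fin n → Fin 2 → ℂ}
    (hab : ∀ i, a i 0 * b i 1 ≠ a i 1 * b i 0)
    (h : ∀ x : Fin n → Fin 2, ‖∏ i, a i (x i) + ∏ i, b i (x i)‖ = 1)
    (ha : ∀ i s, a i s ≠ 0) (hb : ∀ i s, b i s ≠ 0) :
    ∃ i, ∀ j, j ≠ i → ‖b j 0‖ = ‖b j 1‖ := by
  have hconj : ∀ z : ℂ, z ≠ 0 → conj z ≠ 0 := fun z hz => by simpa using hz
  by_cases H : ∃ k, a k 1 * conj (a k 1) * (b k 0 * conj (b k 0)) -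
      a k 0 * conj (a k 0) * (b k 1 * conj (b k 1)) ≠ 0
  · obtain ⟨k, hk⟩ := H
    refine ⟨k, fun j hjk => ?_⟩
    obtain ⟨l, hl⟩ := exists_fin_notMem {j, k} (lt_of_le_of_lt Finset.card_le_two (by omega))
    obtain ⟨l', hl'⟩ := exists_fin_notMem {j, k, l} (lt_of_le_of_lt Finset.card_le_three (by omega))
    simp only [Finset.mem_insert, Finset.mem_singleton, not_or] at hl hl'
    set f : Fin n → Fin 2 → ℂ := fun i =>
      if i = j then annihilator fun _ => 1
      else if i = l then annihilator fun s => a i s * conj (b i s)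
      else if i = l' then annihilator fun s => conj (a i s) * b i s
      else if i = k then annihilator fun s => a i s * conj (a i s)
      else ![1, 0] with hf
    have fj : f j = annihilator fun _ => 1 := by simp [hf]
    have fl : f l = annihilator fun s => a l s * conj (b l s) := by simp [hf, hl.1]
    have fl' : f l' = annihilator fun s => conj (a l' s) * b l' s := by
      simp [hf, hl'.1, hl'.2.2]
    have fk : f k = annihilator fun s => a k s * conj (a k s) := by
      simp [hf, Ne.symm hjk, Ne.symm hl.2, Ne.symm hl'.2.1]
    have fo : ∀ i, i ≠ j → i ≠ l → i ≠ l' → i ≠ k → f i = ![1, 0] := fun i h1 h2 h3 h4 => by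
      simp [hf, h1, h2, h3, h4]
    have key := prod_sum_add_eq_of_norm_eq_one h f
    rw [Finset.prod_eq_zero (i := k) (f := fun i => ∑ s, f i s * (a i s * conj (a i s)))
        (Finset.mem_univ _) (by rw [fk, sum_annihilator_mul]; ring),
      Finset.prod_eq_zero (i := l) (f := fun i => ∑ s, f i s * (a i s * conj (b i s)))
        (Finset.mem_univ _) (by rw [fl, sum_annihilator_mul]; ring),
      Finset.prod_eq_zero (i := l') (f := fun i => ∑ s, f i s * (conj (a i s) * b i s))
        (Finset.mem_univ _) (by rw [fl', sum_annihilator_mul]; ring),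
      Finset.prod_eq_zero (i := j) (f := fun i => ∑ s, f i s * 1)
        (Finset.mem_univ _) (by rw [fj, sum_annihilator_mul fun _ => 1, sub_self]),
      zero_add, add_zero, add_zero] at key
    refine norm_eq_norm_of_prod_annihilator_eq_zero hb hab fj fl fl' (fun i h1 h2 h3 => ?_) key
    by_cases hik : i = k
    · rw [hik, fk, sum_annihilator_mul]
      exact hk
    · rw [fo i h1 h2 h3 hik]
      simp [hb]
  · push Not at H
    -- There is no exceptional site in this case, so the index is arbitrary.
    refine ⟨⟨0, by omega⟩, fun j _ => ?_⟩
    obtain ⟨l, hl⟩ := exists_fin_notMem {j} (by simp; omega)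
    obtain ⟨l', hl'⟩ := exists_fin_notMem {j, l} (lt_of_le_of_lt Finset.card_le_two (by omega))
    simp only [Finset.mem_insert, Finset.mem_singleton, not_or] at hl hl'
    set f : Fin n → Fin 2 → ℂ := fun i =>
      if i = j then annihilator fun _ => 1
      else if i = l then annihilator fun s => a i s * conj (b i s)
      else if i = l' then annihilator fun s => conj (a i s) * b i s
      else ![1, 0] with hf
    have fj : f j = annihilator fun _ => 1 := by simp [hf]
    have fl : f l = annihilator fun s => a l s * conj (b l s) := by simp [hf, hl]
    have fl' : f l' = annihilator fun s => conj (a l' s) * b l' s := by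
      simp [hf, hl'.1, hl'.2]
    have fo : ∀ i, i ≠ j → i ≠ l → i ≠ l' → f i = ![1, 0] := fun i h1 h2 h3 => by
      simp [hf, h1, h2, h3]
    have key := prod_sum_add_eq_of_norm_eq_one h f
    rw [Finset.prod_eq_zero (i := l) (f := fun i => ∑ s, f i s * (a i s * conj (b i s)))
        (Finset.mem_univ _) (by rw [fl, sum_annihilator_mul]; ring),
      Finset.prod_eq_zero (i := l') (f := fun i => ∑ s, f i s * (conj (a i s) * b i s))
        (Finset.mem_univ _) (by rw [fl', sum_annihilator_mul]; ring),
      Finset.prod_eq_zero (i := j) (f := fun i => ∑ s, f i s * 1)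
        (Finset.mem_univ _) (by rw [fj, sum_annihilator_mul fun _ => 1, sub_self]),
      add_zero, add_zero] at key
    have hprop : ∏ i, ∑ s, f i s * (a i s * conj (a i s)) =
        ((∏ i, ‖a i 0‖ ^ 2 / ‖b i 0‖ ^ 2 : ℝ) : ℂ) *
          ∏ i, ∑ s, f i s * (b i s * conj (b i s)) := by
      rw [Complex.ofReal_prod, ← Finset.prod_mul_distrib]
      refine Finset.prod_congr rfl fun i _ => ?_
      have h1 : ((‖a i 0‖ ^ 2 / ‖b i 0‖ ^ 2 : ℝ) : ℂ) =
          a i 0 * conj (a i 0) / (b i 0 * conj (b i 0)) := by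
        rw [Complex.mul_conj', Complex.mul_conj']
        push_cast
        rfl
      have hb0 : b i 0 * conj (b i 0) ≠ 0 := mul_ne_zero (hb i 0) (hconj _ (hb i 0))
      rw [h1, Fin.sum_univ_two, Fin.sum_univ_two, div_mul_eq_mul_div, eq_div_iff hb0]
      linear_combination f i 1 * H i
    have hT : (0 : ℝ) < ∏ i, ‖a i 0‖ ^ 2 / ‖b i 0‖ ^ 2 :=
      Finset.prod_pos fun i _ => div_pos (pow_pos (norm_pos_iff.2 (ha i 0)) 2)
        (pow_pos (norm_pos_iff.2 (hb i 0)) 2)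
    rw [hprop] at key
    refine norm_eq_norm_of_prod_annihilator_eq_zero hb hab fj fl fl' (fun i h1 h2 h3 => ?_) ?_
    · rw [fo i h1 h2 h3]
      simp [hb]
    · have hT' : (((1 + ∏ i, ‖a i 0‖ ^ 2 / ‖b i 0‖ ^ 2 : ℝ)) : ℂ) ≠ 0 :=
        Complex.ofReal_ne_zero.2 (by linarith)
      rw [Complex.ofReal_add, Complex.ofReal_one] at hT'
      refine (mul_eq_zero.1 (Eq.trans ?_ key)).resolve_left hT'
      ring

/-- With bit `i` fixed to `s` the first product is zero, so `∏ b` alone has modulus one, whichever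
value bit `j` takes. -/
theorem norm_eq_norm_of_eq_zero {a b : Fin n → Fin 2 → ℂ}
    (h : ∀ x : Fin n → Fin 2, ‖∏ i, a i (x i) + ∏ i, b i (x i)‖ = 1) {i : Fin n} {s : Fin 2}
    (hi : a i s = 0) {j : Fin n} (hj : j ≠ i) : b j 0 ≠ 0 ∧ ‖b j 0‖ = ‖b j 1‖ := by
  have key : ∀ t, ‖b j t‖ * ‖∏ k ∈ Finset.univ.erase j, b k s‖ = 1 := by
    intro t
    have := h (Function.update (fun _ => s) j t)
    rw [Finset.prod_eq_zero (i := i) (Finset.mem_univ _)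
        (by rw [Function.update_of_ne hj.symm, hi]), zero_add,
      ← Finset.mul_prod_erase _ _ (Finset.mem_univ j), norm_mul, Function.update_self] at this
    rw [← this]
    congr 2
    refine Finset.prod_congr rfl fun k hk => ?_
    rw [Function.update_of_ne (Finset.ne_of_mem_erase hk)]
  have hR : ‖∏ k ∈ Finset.univ.erase j, b k s‖ ≠ 0 := fun h0 => by
    have := key 0
    rw [h0, mul_zero] at this
    exact zero_ne_one this
  refine ⟨fun h0 => ?_, mul_right_cancel₀ hR ((key 0).trans (key 1).symm)⟩
  have := key 0
  rw [h0, norm_zero, zero_mul] at this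
  exact zero_ne_one this

theorem exists_forall_ne_norm_eq (hn : 4 ≤ n) {a b : Fin n → Fin 2 → ℂ}
    (hab : ∀ i, a i 0 * b i 1 ≠ a i 1 * b i 0)
    (h : ∀ x : Fin n → Fin 2, ‖∏ i, a i (x i) + ∏ i, b i (x i)‖ = 1) :
    ∃ i, (∀ j, j ≠ i → b j 0 ≠ 0 ∧ ‖b j 0‖ = ‖b j 1‖) ∨
      (∀ j, j ≠ i → a j 0 ≠ 0 ∧ ‖a j 0‖ = ‖a j 1‖) := by
  by_cases ha : ∃ i s, a i s = 0
  · obtain ⟨i, s, hi⟩ := ha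
    exact ⟨i, Or.inl fun j hj => norm_eq_norm_of_eq_zero h hi hj⟩
  by_cases hb : ∃ i s, b i s = 0
  · obtain ⟨i, s, hi⟩ := hb
    exact ⟨i, Or.inr fun j hj =>
      norm_eq_norm_of_eq_zero (fun x => by rw [add_comm]; exact h x) hi hj⟩
  push Not at ha hb
  obtain ⟨i, hi⟩ := exists_forall_ne_norm_eq_of_ne_zero hn hab h ha hb
  exact ⟨i, Or.inl fun j hj => ⟨hb j 0, hi j hj⟩⟩

variable {m : ℕ}

theorem exists_perm_apply_zero_ne_zero {v : Fin 2 → ℂ} (hv : v 0 ≠ 0 ∨ v 1 ≠ 0) :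
    ∃ τ : Equiv.Perm (Fin 2), v (τ 0) ≠ 0 :=
  hv.elim (fun h => ⟨1, h⟩) fun h => ⟨Equiv.swap 0 1, by rwa [Equiv.swap_apply_left]⟩

theorem apply_perm_mul_ne {a b : Fin 2 → ℂ} (h : a 0 * b 1 ≠ a 1 * b 0) (τ : Equiv.Perm (Fin 2)) :
    a (τ 0) * b (τ 1) ≠ a (τ 1) * b (τ 0) := by
  have h01 : τ 0 ≠ τ 1 := τ.injective.ne (by simp)
  generalize τ 0 = s at h01
  generalize τ 1 = t at h01
  fin_cases s <;> fin_cases t <;> first | exact absurd rfl h01 | exact h | exact h.symm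

/-- The local phases `‖b j 0‖ / b j s` make the `b` term constant on all qubits but the first.
Dividing the other term by its value at bit 0 leaves `w j`, the quotient of `a j 1 / b j 1` by `a j
0 / b j 0`, which differs from 1 by independence. -/
theorem exists_reducedOp_of_apply_zero_ne_zero {a b : Fin (m + 1) → Fin 2 → ℂ}
    (hab : ∀ i, a i 0 * b i 1 ≠ a i 1 * b i 0) (ha : ∀ i, a i 0 ≠ 0)
    (hb : ∀ j : Fin m, b j.succ 0 ≠ 0 ∧ ‖b j.succ 0‖ = ‖b j.succ 1‖) :
    ∃ (d c : Fin 2 → ℂ) (w : Fin m → ℂ), d 0 * c 1 ≠ d 1 * c 0 ∧ (∀ j, w j ≠ 1) ∧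
      PermLUEquivalent (Matrix.diagonal fun x => ∏ i, a i (x i) + ∏ i, b i (x i))
        (reducedOp d c fun j => ![1, w j]) := by
  have hb1 : ∀ j : Fin m, b j.succ 1 ≠ 0 := fun j => by
    rw [← norm_ne_zero_iff, ← (hb j).2]
    exact norm_ne_zero_iff.2 (hb j).1
  have hbs : ∀ (j : Fin m) s, b j.succ s ≠ 0 := fun j s => by
    fin_cases s
    · exact (hb j).1
    · exact hb1 j
  have hbn : ∀ (j : Fin m) s, ‖b j.succ s‖ = ‖b j.succ 0‖ := fun j s => by
    fin_cases s
    · rfl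
    · exact (hb j).2.symm
  set φ : Fin (m + 1) → Fin 2 → ℂ :=
    Fin.cons (fun _ => 1) fun j s => (‖b j.succ 0‖ : ℂ) / b j.succ s with hφ
  have hφn : ∀ i s, ‖φ i s‖ = 1 := by
    intro i s
    refine Fin.cases (by simp [hφ]) (fun j => ?_) i
    simp only [hφ, Fin.cons_succ, norm_div, Complex.norm_real, norm_norm, hbn]
    exact div_self (norm_ne_zero_iff.2 (hb j).1)
  set B : ℂ := ∏ j : Fin m, (‖b j.succ 0‖ : ℂ) with hB
  set C : ℂ := ∏ j : Fin m, (‖b j.succ 0‖ : ℂ) / b j.succ 0 * a j.succ 0 with hC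
  have hn0 : ∀ j : Fin m, (‖b j.succ 0‖ : ℂ) ≠ 0 := fun j =>
    Complex.ofReal_ne_zero.2 (norm_ne_zero_iff.2 (hb j).1)
  have hB0 : B ≠ 0 := Finset.prod_ne_zero_iff.2 fun j _ => hn0 j
  have hC0 : C ≠ 0 := Finset.prod_ne_zero_iff.2 fun j _ =>
    mul_ne_zero (div_ne_zero (hn0 j) (hb j).1) (ha _)
  refine ⟨fun s => B * b 0 s, fun s => a 0 s * C,
    fun j => (a j.succ 1 / b j.succ 1) / (a j.succ 0 / b j.succ 0), ?_, ?_, ?_⟩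
  · intro h0
    have h1 : B * C * (a 0 0 * b 0 1 - a 0 1 * b 0 0) = 0 := by linear_combination -h0
    exact mul_ne_zero (mul_ne_zero hB0 hC0) (sub_ne_zero.2 (hab 0)) h1
  · intro j h0
    rw [div_eq_one_iff_eq (div_ne_zero (ha _) (hb j).1), div_eq_div_iff (hb1 j) (hb j).1] at h0
    exact hab j.succ h0.symm
  · convert permLUEquivalent_diagonal_phase hφn _ using 1
    rw [reducedOp]
    congr 1
    ext1 x
    simp only [Fin.prod_univ_succ, hφ, Fin.cons_zero, Fin.cons_succ, one_mul]
    have h1 : (∏ j : Fin m, (‖b j.succ 0‖ : ℂ) / b j.succ (x j.succ)) *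
        ∏ j : Fin m, b j.succ (x j.succ) = B := by
      rw [← Finset.prod_mul_distrib]
      exact Finset.prod_congr rfl fun j _ => div_mul_cancel₀ _ (hbs j _)
    have h2 : (∏ j : Fin m, (‖b j.succ 0‖ : ℂ) / b j.succ (x j.succ)) *
        ∏ j : Fin m, a j.succ (x j.succ) = C * ∏ j : Fin m, (![1, (a j.succ 1 / b j.succ 1) /
          (a j.succ 0 / b j.succ 0)] : Fin 2 → ℂ) (x j.succ) := by
      rw [← Finset.prod_mul_distrib, ← Finset.prod_mul_distrib]
      refine Finset.prod_congr rfl fun j _ => ?_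
      have e0 := (hb j).1
      have e1 := hb1 j
      have e2 := ha j.succ
      generalize x j.succ = s
      fin_cases s
      · simp
      · simp
        field_simp
    linear_combination (-b 0 (x 0)) * h1 - a 0 (x 0) * h2

theorem exists_reducedOp_of_norm_eq {a b : Fin (m + 1) → Fin 2 → ℂ}
    (hab : ∀ i, a i 0 * b i 1 ≠ a i 1 * b i 0)
    (hb : ∀ j : Fin m, b j.succ 0 ≠ 0 ∧ ‖b j.succ 0‖ = ‖b j.succ 1‖) :
    ∃ (d c : Fin 2 → ℂ) (w : Fin m → ℂ), d 0 * c 1 ≠ d 1 * c 0 ∧ (∀ j, w j ≠ 1) ∧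
      PermLUEquivalent (Matrix.diagonal fun x => ∏ i, a i (x i) + ∏ i, b i (x i))
        (reducedOp d c fun j => ![1, w j]) := by
  have ha : ∀ i, a i 0 ≠ 0 ∨ a i 1 ≠ 0 := by
    intro i
    by_contra! h0
    exact hab i (by rw [h0.1, h0.2, zero_mul, zero_mul])
  -- Bit flips arrange `a i 0 ≠ 0`; equality of the moduli of `b` is unaffected.
  choose τ hτ using fun i => exists_perm_apply_zero_ne_zero (ha i)
  obtain ⟨d, c, w, hdc, hw, hred⟩ := exists_reducedOp_of_apply_zero_ne_zero
    (a := fun i s => a i (τ i s)) (b := fun i s => b i (τ i s))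
    (fun i => apply_perm_mul_ne (hab i) (τ i)) hτ (fun j => by
      have hbs : ∀ s, b j.succ s ≠ 0 ∧ ‖b j.succ s‖ = ‖b j.succ 0‖ := fun s => by
        fin_cases s
        · exact ⟨(hb j).1, rfl⟩
        · refine ⟨?_, (hb j).2.symm⟩
          change b j.succ 1 ≠ 0
          rw [← norm_ne_zero_iff, ← (hb j).2]
          exact norm_ne_zero_iff.2 (hb j).1
      exact ⟨(hbs _).1, (hbs _).2.trans (hbs _).2.symm⟩)
  exact ⟨d, c, w, hdc, hw, (permLUEquivalent_diagonal_flip τ _).trans hred⟩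

theorem exists_reducedOp (hm : 3 ≤ m) {a b : Fin (m + 1) → Fin 2 → ℂ}
    (hab : ∀ i, a i 0 * b i 1 ≠ a i 1 * b i 0)
    (h : ∀ x : Fin (m + 1) → Fin 2, ‖∏ i, a i (x i) + ∏ i, b i (x i)‖ = 1) :
    ∃ (d c : Fin 2 → ℂ) (w : Fin m → ℂ), d 0 * c 1 ≠ d 1 * c 0 ∧ (∀ j, w j ≠ 1) ∧
      PermLUEquivalent (Matrix.diagonal fun x => ∏ i, a i (x i) + ∏ i, b i (x i))
        (reducedOp d c fun j => ![1, w j]) := by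
  have key : ∀ a b : Fin (m + 1) → Fin 2 → ℂ, (∀ i, a i 0 * b i 1 ≠ a i 1 * b i 0) → ∀ i,
      (∀ j, j ≠ i → b j 0 ≠ 0 ∧ ‖b j 0‖ = ‖b j 1‖) →
      ∃ (d c : Fin 2 → ℂ) (w : Fin m → ℂ), d 0 * c 1 ≠ d 1 * c 0 ∧ (∀ j, w j ≠ 1) ∧
      PermLUEquivalent (Matrix.diagonal fun x => ∏ i, a i (x i) + ∏ i, b i (x i))
        (reducedOp d c fun j => ![1, w j]) := by
    intro a b hab i hi
    set σ := Equiv.swap 0 i with hσ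
    obtain ⟨d, c, w, hdc, hw, hred⟩ := exists_reducedOp_of_norm_eq
      (a := fun j => a (σ j)) (b := fun j => b (σ j)) (fun j => hab _)
      (fun j => hi _ fun h0 => Fin.succ_ne_zero j (σ.injective
        (by rw [h0, hσ, Equiv.swap_apply_left])))
    refine ⟨d, c, w, hdc, hw, (permLUEquivalent_diagonal_perm σ _).trans ?_⟩
    convert hred using 3 with x
    congr 1
    · rw [← Equiv.prod_comp σ]
      simp [hσ]
    · rw [← Equiv.prod_comp σ]
      simp [hσ]
  obtain ⟨i, hi | hi⟩ := exists_forall_ne_norm_eq (by omega) hab h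
  · exact key a b hab i hi
  · have := key b a (fun i h0 => hab i (by linear_combination -h0)) i hi
    simpa only [add_comm] using this

end Reduction

/-! ### Equivalences between reduced forms. -/

section ReducedEquivalence

variable {m : ℕ}

theorem permLUEquivalent_reducedOp_phase {φ : Fin 2 → ℂ} (hφ : ∀ s, ‖φ s‖ = 1) (d c : Fin 2 → ℂ)
    (w : Fin m → Fin 2 → ℂ) :
    PermLUEquivalent (reducedOp d c w) (reducedOp (fun s => φ s * d s) (fun s => φ s * c s) w) := by
  have hφ' : ∀ i s, ‖(Fin.cons φ fun _ _ => 1 : Fin (m + 1) → Fin 2 → ℂ) i s‖ = 1 := by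
    intro i s
    refine Fin.cases ?_ (fun j => ?_) i
    · simpa using hφ s
    · simp
  convert permLUEquivalent_diagonal_phase hφ'
    (fun x => d (x 0) + c (x 0) * ∏ j, w j (x j.succ)) using 1
  · rw [reducedOp]
  rw [reducedOp]
  congr 1
  ext1 x
  simp only [Fin.prod_univ_succ, Fin.cons_zero, Fin.cons_succ, Finset.prod_const_one, mul_one]
  ring

theorem permLUEquivalent_reducedOp_flip (d c : Fin 2 → ℂ) (w : Fin m → Fin 2 → ℂ) :
    PermLUEquivalent (reducedOp d c w) (reducedOp ![d 1, d 0] ![c 1, c 0] w) := by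
  convert permLUEquivalent_diagonal_flip
    (Fin.cons (Equiv.swap 0 1) fun _ => 1 : Fin (m + 1) → Equiv.Perm (Fin 2))
    (fun x => d (x 0) + c (x 0) * ∏ j, w j (x j.succ)) using 1
  · rw [reducedOp]
  rw [reducedOp]
  congr 1
  ext1 x
  simp only [Fin.cons_zero, Fin.cons_succ, Equiv.Perm.coe_one, id]
  generalize x 0 = s
  fin_cases s <;> simp

/-- Multiply by `σ₃` on every qubit but the first: the sign product squares to 1, so the two terms
trade places. -/
theorem permLUEquivalent_reducedOp_swap (d c : Fin 2 → ℂ) :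
    PermLUEquivalent (reducedOp d c fun _ : Fin m => ![1, -1])
      (reducedOp c d fun _ : Fin m => ![1, -1]) := by
  have hφ : ∀ i s, ‖(Fin.cons (fun _ => 1) fun _ => ![1, -1] : Fin (m + 1) → Fin 2 → ℂ) i s‖ =
      1 := by
    intro i s
    refine Fin.cases ?_ (fun j => ?_) i
    · simp
    · fin_cases s <;> simp
  convert permLUEquivalent_diagonal_phase hφ
    (fun x => d (x 0) + c (x 0) * ∏ j : Fin m, (![1, -1] : Fin 2 → ℂ) (x j.succ)) using 1
  · rw [reducedOp]
  rw [reducedOp]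
  congr 1
  ext1 x
  simp only [Fin.prod_univ_succ, Fin.cons_zero, Fin.cons_succ, one_mul]
  have : (∏ j : Fin m, (![1, -1] : Fin 2 → ℂ) (x j.succ)) *
      ∏ j : Fin m, (![1, -1] : Fin 2 → ℂ) (x j.succ) = 1 := by
    rcases prod_one_neg_one fun j => x (Fin.succ j) with h | h <;> rw [h] <;> norm_num
  linear_combination -c (x 0) * this

/-- `U` is equivalent to one of the five families of normal forms. -/
def HasNormalForm (U : NQubitOp (m + 1)) : Prop :=
  (∃ θ ∈ Set.Ioo 0 (2 * Real.pi), PermLUEquivalent U (formAll (m + 1) θ)) ∨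
  (∃ θ ∈ Set.Ioo 0 (2 * Real.pi), ∃ φ ∈ Set.Ioo 0 (2 * Real.pi), θ ≠ φ ∧
    PermLUEquivalent U (formAllButOne (m + 1) θ φ)) ∨
  (∃ β : Fin (m + 1) → ℝ, (∀ i : Fin (m + 1), (i : ℕ) ≠ 0 → β i ∈ Set.Ioo 0 (2 * Real.pi)) ∧
    PermLUEquivalent U (formTwo (m + 1) β)) ∨
  (∃ α ∈ Set.Ioo 0 (Real.pi / 2) ∪ Set.Ioo (Real.pi / 2) Real.pi,
    PermLUEquivalent U (formOne (m + 1) α)) ∨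
  (∃ α ∈ nonQuarterAngles, ∃ β ∈ nonQuarterAngles, Real.sin (α - β) ≠ 0 ∧
    PermLUEquivalent U (formZero (m + 1) α β))

theorem PermLUEquivalent.hasNormalForm {U V : NQubitOp (m + 1)} (h : PermLUEquivalent U V)
    (hV : HasNormalForm V) : HasNormalForm U := by
  rcases hV with ⟨θ, hθ, hV⟩ | ⟨θ, hθ, φ, hφ, hne, hV⟩ | ⟨β, hβ, hV⟩ | ⟨α, hα, hV⟩ |
    ⟨α, hα, β, hβ, hne, hV⟩
  · exact Or.inl ⟨θ, hθ, h.trans hV⟩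
  · exact Or.inr (Or.inl ⟨θ, hθ, φ, hφ, hne, h.trans hV⟩)
  · exact Or.inr (Or.inr (Or.inl ⟨β, hβ, h.trans hV⟩))
  · exact Or.inr (Or.inr (Or.inr (Or.inl ⟨α, hα, h.trans hV⟩)))
  · exact Or.inr (Or.inr (Or.inr (Or.inr ⟨α, hα, β, hβ, hne, h.trans hV⟩)))

theorem PermLUEquivalent.refl {n : ℕ} (U : NQubitOp n) : PermLUEquivalent U U :=
  ⟨Equiv.refl _, fun _ => 1, fun _ => 1, fun _ => one_mem _, fun _ => one_mem _, by
    rw [prodOp_one, one_mul, mul_one, permuteQubits_refl]⟩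

end ReducedEquivalence

/-! ### Angle parametrizations. -/

section Angles

theorem exists_exp_eq_of_norm_eq_one {z : ℂ} (hz : ‖z‖ = 1) (h1 : z ≠ 1) :
    ∃ θ ∈ Set.Ioo 0 (2 * Real.pi), Complex.exp (Complex.I * θ) = z := by
  have hexp : Complex.exp (Complex.I * (Complex.arg z : ℂ)) = z := by
    have := Complex.norm_mul_exp_arg_mul_I z
    rwa [hz, Complex.ofReal_one, one_mul, mul_comm] at this
  have h0 : Complex.arg z ≠ 0 := by
    intro h
    rw [h] at hexp
    exact h1 (by simpa using hexp.symm)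
  have hpi := Real.pi_pos
  rcases lt_or_gt_of_ne h0 with h | h
  · refine ⟨Complex.arg z + 2 * Real.pi, ⟨?_, ?_⟩, ?_⟩
    · linarith [Complex.neg_pi_lt_arg z]
    · linarith
    · push_cast
      rw [mul_add, Complex.exp_add, hexp, mul_comm Complex.I (2 * _), Complex.exp_two_pi_mul_I,
        mul_one]
  · exact ⟨Complex.arg z, ⟨h, by linarith [Complex.arg_le_pi z]⟩, hexp⟩

/-- By `h2`, `conj d * c` is purely imaginary, say `i y`. Then `ω = d / ‖d‖` and `α = arccos (y /
‖d‖)` work, with `sin α = ‖d‖ > 0`. -/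
theorem exists_angle_of_orthogonal {d c : ℂ} (hd : d ≠ 0) (h1 : c * conj c + d * conj d = 1)
    (h2 : conj d * c + d * conj c = 0) :
    ∃ (ω : ℂ) (α : ℝ), ‖ω‖ = 1 ∧ α ∈ Set.Ioo 0 Real.pi ∧ d = ω * (Real.sin α : ℂ) ∧
      c = ω * (Complex.I * (Real.cos α : ℂ)) := by
  have hn : 0 < ‖d‖ := norm_pos_iff.2 hd
  have hnC : (‖d‖ : ℂ) ≠ 0 := Complex.ofReal_ne_zero.2 hn.ne'
  set y : ℝ := (conj d * c).im with hy
  have hdc : conj d * c = y * Complex.I := by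
    have hre : (conj d * c).re = 0 := by
      have := congrArg Complex.re h2
      simp at this ⊢
      linarith
    apply Complex.ext <;> simp [hre, hy]
  have hdd : d * conj d = (‖d‖ : ℂ) ^ 2 := Complex.mul_conj' d
  have hsum : (y / ‖d‖) ^ 2 + ‖d‖ ^ 2 = 1 := by
    have e1 : ‖c‖ ^ 2 + ‖d‖ ^ 2 = 1 := by
      rw [Complex.mul_conj', Complex.mul_conj'] at h1
      exact_mod_cast h1
    have e2 : ‖d‖ * ‖c‖ = |y| := by
      have := congrArg norm hdc
      simpa using this
    rw [div_pow, ← sq_abs y, ← e2, mul_pow, mul_div_cancel_left₀ _ (pow_ne_zero 2 hn.ne')]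
    exact e1
  have hq : -1 ≤ y / ‖d‖ ∧ y / ‖d‖ ≤ 1 :=
    abs_le.1 ((sq_le_one_iff_abs_le_one _).1 (by nlinarith [sq_nonneg ‖d‖]))
  have hcos : Real.cos (Real.arccos (y / ‖d‖)) = y / ‖d‖ := Real.cos_arccos hq.1 hq.2
  have hsin : Real.sin (Real.arccos (y / ‖d‖)) = ‖d‖ := by
    rw [Real.sin_arccos, ← hsum, add_sub_cancel_left, Real.sqrt_sq hn.le]
  refine ⟨d / ‖d‖, Real.arccos (y / ‖d‖), ?_, ⟨?_, ?_⟩, ?_, ?_⟩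
  · rw [norm_div, Complex.norm_real, norm_norm, div_self hn.ne']
  · refine lt_of_le_of_ne (Real.arccos_nonneg _) fun h0 => hn.ne ?_
    rw [← hsin, ← h0, Real.sin_zero]
  · refine lt_of_le_of_ne (Real.arccos_le_pi _) fun h0 => hn.ne ?_
    rw [← hsin, h0, Real.sin_pi]
  · rw [hsin, div_mul_cancel₀ _ hnC]
  · rw [hcos]
    push_cast
    field_simp
    linear_combination -c * hdd + d * hdc

theorem mem_nonQuarterAngles {α : ℝ} (h : α ∈ Set.Ico 0 (2 * Real.pi)) (hs : Real.sin α ≠ 0)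
    (hc : Real.cos α ≠ 0) : α ∈ nonQuarterAngles := by
  refine ⟨h, fun j hj => ?_⟩
  fin_cases j <;> simp at hj
  · exact hs (by rw [hj, Real.sin_zero])
  · exact hc (by rw [hj, Real.cos_pi_div_two])
  · exact hs (by rw [hj, Real.sin_pi])
  · refine hc ?_
    rw [hj, show 3 * Real.pi / 2 = Real.pi / 2 + Real.pi by ring, Real.cos_add_pi,
      Real.cos_pi_div_two, neg_zero]

theorem exists_nonQuarterAngle_of_orthogonal {d c : ℂ} (hd : d ≠ 0) (hc : c ≠ 0)
    (h1 : c * conj c + d * conj d = 1) (h2 : conj d * c + d * conj c = 0) :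
    ∃ (ω : ℂ) (α : ℝ), ‖ω‖ = 1 ∧ α ∈ nonQuarterAngles ∧ d = ω * (Real.cos α : ℂ) ∧
      c = ω * (Complex.I * (Real.sin α : ℂ)) := by
  obtain ⟨ω, α, hω, hα, rfl, rfl⟩ := exists_angle_of_orthogonal hd h1 h2
  have hs : Real.sin α ≠ 0 := fun h0 => hd (by rw [h0]; simp)
  have hcs : Real.cos α ≠ 0 := fun h0 => hc (by rw [h0]; simp)
  -- `β` is `π/2 - α` modulo `2π`, which exchanges sine and cosine.
  obtain ⟨β, hβ, h3, h4⟩ : ∃ β ∈ Set.Ico 0 (2 * Real.pi), Real.cos β = Real.sin α ∧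
      Real.sin β = Real.cos α := by
    have hpi := Real.pi_pos
    rcases le_or_gt α (Real.pi / 2) with h | h
    · exact ⟨Real.pi / 2 - α, ⟨by linarith, by linarith [hα.1]⟩, Real.cos_pi_div_two_sub α,
        Real.sin_pi_div_two_sub α⟩
    · refine ⟨Real.pi / 2 - α + 2 * Real.pi, ⟨by linarith [hα.2], by linarith⟩, ?_, ?_⟩
      · rw [Real.cos_add_two_pi, Real.cos_pi_div_two_sub]
      · rw [Real.sin_add_two_pi, Real.sin_pi_div_two_sub]
  exact ⟨ω, β, hω, mem_nonQuarterAngles hβ (h4 ▸ hcs) (h3 ▸ hs), by rw [h3], by rw [h4]⟩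

end Angles

/-! ### Points on circles. -/

section Circles

theorem eq_of_quadratic {A B C x y v : ℂ} (hA : A ≠ 0) (hx : A * x ^ 2 + B * x + C = 0)
    (hy : A * y ^ 2 + B * y + C = 0) (hv : A * v ^ 2 + B * v + C = 0) (hxy : x ≠ y) (hxv : v ≠ x) :
    v = y := by
  have h1 : A * (x + y) + B = 0 := (mul_eq_zero.1
    (show (x - y) * (A * (x + y) + B) = 0 by linear_combination hx - hy)).resolve_left
      (sub_ne_zero.2 hxy)
  have h2 : A * (v + x) + B = 0 := (mul_eq_zero.1
    (show (v - x) * (A * (v + x) + B) = 0 by linear_combination hv - hx)).resolve_left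
      (sub_ne_zero.2 hxv)
  refine sub_eq_zero.1 ((mul_eq_zero.1 (show A * (v - y) = 0 from ?_)).resolve_left hA)
  linear_combination h2 - h1

theorem circle_eq_of_norm_eq_one {d z : ℂ} (h : ‖d + z‖ = 1) :
    z * conj z + conj d * z + d * conj z + (d * conj d - 1) = 0 := by
  have := Complex.mul_conj' (d + z)
  rw [h, map_add] at this
  push_cast at this
  linear_combination this

/-- Each `z = c p` lies on the circles `‖d + z‖ = 1` and `‖d + r z‖ = 1`, whose centres `-d` and `-d
/ r` differ. So `1, s, t, s t` take at most two values: `t = s`, then `s t = 1`, and `s² = 1` with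
`s ≠ 1`. -/
theorem eq_neg_one_of_norm_eq_one {d c r s t : ℂ} (hd : d ≠ 0) (hc : c ≠ 0) (hr : r ≠ 0)
    (hr1 : r ≠ 1) (hs : s ≠ 0) (hs1 : s ≠ 1) (ht1 : t ≠ 1)
    (h : ∀ p ∈ ({1, s, t, s * t} : Set ℂ), ‖d + c * p‖ = 1 ∧ ‖d + c * (r * p)‖ = 1) :
    s = -1 := by
  have hα : -(conj d * r * (conj r - 1)) ≠ 0 := by
    have : conj r ≠ 1 := fun h0 => hr1 (by simpa using congrArg conj h0)
    refine neg_ne_zero.2 (mul_ne_zero (mul_ne_zero (by simpa using hd) hr) (sub_ne_zero.2 this))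
  -- Eliminating `conj z` from the two circle equations leaves a quadratic in `z = c p` with nonzero
  -- leading coefficient `hα`.
  have key : ∀ p ∈ ({1, s, t, s * t} : Set ℂ),
      -(conj d * r * (conj r - 1)) * (c * p) ^ 2 +
        (-((d * conj d - 1) * (r * conj r - 1)) + d * conj r * (r - 1) * conj d -
          d * (conj d * r * (conj r - 1))) * (c * p) +
        (-(d * ((d * conj d - 1) * (r * conj r - 1))) +
          d * conj r * (r - 1) * (d * conj d - 1)) = 0 := by
    intro p hp
    have h1 := circle_eq_of_norm_eq_one (h p hp).1
    have h2 := circle_eq_of_norm_eq_one (h p hp).2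
    simp only [map_mul] at h1 h2
    linear_combination (d * conj r * (r - 1)) * h1 - (c * p + d) * (r * conj r * h1 - h2)
  have k1 := key 1 (by simp)
  have k2 := key s (by simp)
  have k3 := key t (by simp)
  have k4 := key (s * t) (by simp)
  have hne : c * 1 ≠ c * s := fun h0 => hs1 (mul_left_cancel₀ hc h0).symm
  have hst : t = s := mul_left_cancel₀ hc (eq_of_quadratic hα k1 k2 k3 hne
    fun h0 => ht1 (mul_left_cancel₀ hc h0))
  by_cases h1 : s * t = 1
  · rw [hst] at h1
    exact (mul_self_eq_one_iff.1 h1).resolve_left hs1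
  · have := mul_left_cancel₀ hc (eq_of_quadratic hα k1 k2 k4 hne
      fun h0 => h1 (mul_left_cancel₀ hc h0))
    exact absurd (mul_left_cancel₀ hs (this.trans (mul_one s).symm)) ht1

theorem orthogonal_of_norm_eq_one {d c : ℂ} (h1 : ‖d + c‖ = 1) (h2 : ‖d + -c‖ = 1) :
    c * conj c + d * conj d = 1 ∧ conj d * c + d * conj c = 0 := by
  have e1 := circle_eq_of_norm_eq_one h1
  have e2 := circle_eq_of_norm_eq_one h2
  rw [map_neg] at e2
  exact ⟨by linear_combination (e1 + e2) / 2, by linear_combination (e1 - e2) / 2⟩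

/-- A rank one `2 × 2` array with pairwise distinct rows and columns cannot lie on the circle
`‖1 + z‖ = 1` punctured at the origin. -/
theorem not_norm_one_add_eq_one {z r t : ℂ} (hz : z ≠ 0) (hr : r ≠ 0) (ht : t ≠ 0) (hr1 : r ≠ 1)
    (ht1 : t ≠ 1) (h1 : ‖1 + z‖ = 1) (h2 : ‖1 + z * r‖ = 1) (h3 : ‖1 + z * t‖ = 1)
    (h4 : ‖1 + z * (r * t)‖ = 1) : False := by
  -- Inversion sends this circle through the origin to the line `1 + 2 Re y = 0`.
  have key : ∀ v : ℂ, v ≠ 0 → ‖1 + v‖ = 1 → 1 + v⁻¹ + conj v⁻¹ = 0 := by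
    intro v hv h
    have e := circle_eq_of_norm_eq_one h
    simp only [map_one, one_mul, mul_one, sub_self, add_zero] at e
    have hv' : conj v ≠ 0 := by simpa using hv
    rw [map_inv₀]
    field_simp
    linear_combination e
  have k1 := key z hz h1
  have k2 := key _ (mul_ne_zero hz hr) h2
  have k3 := key _ (mul_ne_zero hz ht) h3
  have k4 := key _ (mul_ne_zero hz (mul_ne_zero hr ht)) h4
  simp only [mul_inv, map_mul] at k2 k3 k4
  set y := z⁻¹ with hy
  set ρ := r⁻¹ with hρ
  set τ := t⁻¹ with hτ
  have hy0 : y ≠ 0 := inv_ne_zero hz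
  have hτ1 : τ ≠ 1 := fun h0 => ht1 (inv_eq_one.1 h0)
  have hρ1 : ρ ≠ 1 := fun h0 => hr1 (inv_eq_one.1 h0)
  -- With `y`, `yρ`, `yτ`, `yρτ` all on the line, `ρ` is real. A real multiple of `y` on the same
  -- line equals `y`, so `ρ = 1`.
  have e : (ρ - conj ρ) * ((τ - 1) * y) = 0 := by
    linear_combination (k4 - conj ρ * conj τ * k1) - (k2 - conj ρ * k1) -
      conj ρ * (k3 - conj τ * k1)
  have e' : ρ - conj ρ = 0 :=
    (mul_eq_zero.1 e).resolve_right (mul_ne_zero (sub_ne_zero.2 hτ1) hy0)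
  refine hρ1 ?_
  linear_combination ρ * k1 - k2 - conj y * e'

end Circles

/-! ### From the reduced form to the five families. -/

section NormalForms

variable {m : ℕ}

theorem hasNormalForm_of_opposite_signs {d c : Fin 2 → ℂ} (hd : ∀ s, d s ≠ 0) (hc : ∀ s, c s ≠ 0)
    (hdc : d 0 * c 1 ≠ d 1 * c 0) (h1 : ∀ s, c s * conj (c s) + d s * conj (d s) = 1)
    (h2 : ∀ s, conj (d s) * c s + d s * conj (c s) = 0) :
    HasNormalForm (reducedOp d c fun _ : Fin m => ![1, -1]) := by
  choose ω α hω hα hdα hcα using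
    fun s => exists_nonQuarterAngle_of_orthogonal (hd s) (hc s) (h1 s) (h2 s)
  have hω0 : ∀ s, ω s ≠ 0 := fun s h0 => by
    have := hω s
    rw [h0, norm_zero] at this
    exact zero_ne_one this
  refine Or.inr (Or.inr (Or.inr (Or.inr ⟨α 0, hα 0, α 1, hα 1, fun h0 => hdc ?_, ?_⟩)))
  · rw [Real.sin_sub, sub_eq_zero] at h0
    have h0' : (Real.sin (α 0) : ℂ) * Real.cos (α 1) = Real.cos (α 0) * Real.sin (α 1) := by
      exact_mod_cast h0
    rw [hdα, hcα, hdα, hcα]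
    linear_combination -ω 0 * ω 1 * Complex.I * h0'
  · have h := permLUEquivalent_reducedOp_phase (φ := fun s => (ω s)⁻¹)
      (fun s => by rw [norm_inv, hω, inv_one]) d c fun _ : Fin m => ![1, -1]
    convert h using 1
    rw [formZero_eq]
    congr 1 <;> ext s <;> fin_cases s <;>
      simp only [Fin.zero_eta, Fin.mk_one, Matrix.cons_val_zero, Matrix.cons_val_one]
    · rw [hdα, inv_mul_cancel_left₀ (hω0 _)]
    · rw [hdα, inv_mul_cancel_left₀ (hω0 _)]
    · rw [hcα, inv_mul_cancel_left₀ (hω0 _)]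
    · rw [hcα, inv_mul_cancel_left₀ (hω0 _)]

theorem hasNormalForm_of_opposite_signs_of_eq_zero {d c : Fin 2 → ℂ} (hd : d 0 ≠ 0) (hc : c 0 ≠ 0)
    (hc1 : c 1 = 0) (h1 : ∀ s, c s * conj (c s) + d s * conj (d s) = 1)
    (h2 : ∀ s, conj (d s) * c s + d s * conj (c s) = 0) :
    HasNormalForm (reducedOp d c fun _ : Fin m => ![1, -1]) := by
  obtain ⟨ω, α, hω, hα, hdα, hcα⟩ := exists_angle_of_orthogonal hd (h1 0) (h2 0)
  have hω0 : ω ≠ 0 := fun h0 => by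
    rw [h0, norm_zero] at hω
    exact zero_ne_one hω
  have hα' : α ≠ Real.pi / 2 := fun h0 => hc (by rw [hcα, h0]; simp)
  have hd1 : ‖d 1‖ = 1 := by
    have := h1 1
    rw [hc1, zero_mul, zero_add, Complex.mul_conj'] at this
    exact (pow_eq_one_iff_of_nonneg (norm_nonneg _) two_ne_zero).1 (by exact_mod_cast this)
  have hd10 : d 1 ≠ 0 := fun h0 => by
    rw [h0, norm_zero] at hd1
    exact zero_ne_one hd1
  refine Or.inr (Or.inr (Or.inr (Or.inl ⟨α, ?_, ?_⟩)))
  · rcases lt_or_gt_of_ne hα' with h | h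
    · exact Or.inl ⟨hα.1, h⟩
    · exact Or.inr ⟨h, hα.2⟩
  · have h := permLUEquivalent_reducedOp_phase (φ := ![ω⁻¹, (d 1)⁻¹])
      (fun s => by fin_cases s <;> simp [hω, hd1]) d c fun _ : Fin m => ![1, -1]
    convert h using 1
    rw [formOne_eq]
    congr 1 <;> ext s <;> fin_cases s <;>
      simp only [Fin.zero_eta, Fin.mk_one, Matrix.cons_val_zero, Matrix.cons_val_one]
    · rw [hdα, inv_mul_cancel_left₀ hω0]
    · rw [inv_mul_cancel₀ hd10]
    · rw [hcα, inv_mul_cancel_left₀ hω0]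
    · rw [hc1, mul_zero]

theorem hasNormalForm_of_opposite_signs_of_ne_zero {d c : Fin 2 → ℂ} (hd : d 0 ≠ 0) (hc : c 0 ≠ 0)
    (hdc : d 0 * c 1 ≠ d 1 * c 0) (h1 : ∀ s, c s * conj (c s) + d s * conj (d s) = 1)
    (h2 : ∀ s, conj (d s) * c s + d s * conj (c s) = 0) :
    HasNormalForm (reducedOp d c fun _ : Fin m => ![1, -1]) := by
  by_cases hc1 : c 1 = 0
  · exact hasNormalForm_of_opposite_signs_of_eq_zero hd hc hc1 h1 h2
  by_cases hd1 : d 1 = 0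
  · exact (permLUEquivalent_reducedOp_swap d c).hasNormalForm
      (hasNormalForm_of_opposite_signs_of_eq_zero hc hd hd1
        (fun s => by linear_combination h1 s) fun s => by linear_combination h2 s)
  exact hasNormalForm_of_opposite_signs (fun s => by fin_cases s <;> assumption)
    (fun s => by fin_cases s <;> assumption) hdc h1 h2

theorem hasNormalForm_of_controlled {d c : Fin 2 → ℂ} {w : Fin m → ℂ} (hw : ∀ j, w j ≠ 1)
    (hwn : ∀ j, ‖w j‖ = 1) (hd : ‖d 0‖ = 1) (hd1 : d 1 = 0) (hc0 : c 0 = 0) (hc : ‖c 1‖ = 1) :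
    HasNormalForm (reducedOp d c fun j => ![1, w j]) := by
  choose β hβ hβw using fun j => exists_exp_eq_of_norm_eq_one (hwn j) (hw j)
  have hd0 : d 0 ≠ 0 := norm_ne_zero_iff.1 (by rw [hd]; exact one_ne_zero)
  have hc1 : c 1 ≠ 0 := norm_ne_zero_iff.1 (by rw [hc]; exact one_ne_zero)
  refine Or.inr (Or.inr (Or.inl ⟨Fin.cons 0 β, fun i => ?_, ?_⟩))
  · refine Fin.cases (fun h => absurd rfl h) (fun j _ => ?_) i
    simpa using hβ j
  · have h := permLUEquivalent_reducedOp_phase (φ := ![(d 0)⁻¹, (c 1)⁻¹])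
      (fun s => by fin_cases s <;> simp [hd, hc]) d c fun j => ![1, w j]
    convert h using 1
    rw [formTwo_eq]
    simp only [Fin.cons_succ, hβw]
    congr 1 <;> ext s <;> fin_cases s <;> simp [hd0, hd1, hc0, hc1]

/-- If `d s` and `c s` are both nonzero for some `s`, the circle argument makes every `w j` equal to
`-1`. Otherwise `d` and `c` have complementary supports and the gate is controlled by the first
qubit. -/
theorem hasNormalForm_of_ne_zero (hm : 3 ≤ m) {d c : Fin 2 → ℂ} {w : Fin m → ℂ}
    (hdc : d 0 * c 1 ≠ d 1 * c 0) (hw : ∀ j, w j ≠ 1) (hw0 : ∀ j, w j ≠ 0)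
    (h : ∀ s (S : Finset (Fin m)), ‖d s + c s * ∏ j ∈ S, w j‖ = 1) :
    HasNormalForm (reducedOp d c fun j => ![1, w j]) := by
  by_cases hs : ∃ s, d s ≠ 0 ∧ c s ≠ 0
  · obtain ⟨s, hds, hcs⟩ := hs
    have hneg : ∀ j, w j = -1 := by
      intro j
      obtain ⟨k, hk, -⟩ := exists_fin_ne_ne hm j j
      obtain ⟨l, hlj, hlk⟩ := exists_fin_ne_ne hm j k
      -- Three distinct sites `j`, `k`, `l` supply the parameters `s`, `t`, `r`; hence `3 ≤ m`.
      refine eq_neg_one_of_norm_eq_one (r := w l) (t := w k) hds hcs (hw0 l) (hw l) (hw0 j) (hw j)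
        (hw k) ?_
      have e := h s
      rintro p (rfl | rfl | rfl | rfl)
      · exact ⟨by simpa using e ∅, by simpa using e {l}⟩
      · exact ⟨by simpa using e {j}, by simpa [hlj] using e {l, j}⟩
      · exact ⟨by simpa using e {k}, by simpa [hlk] using e {l, k}⟩
      · exact ⟨by simpa [hk.symm] using e {j, k}, by simpa [hlj, hlk, hk.symm] using e {l, j, k}⟩
    have horth : ∀ s, c s * conj (c s) + d s * conj (d s) = 1 ∧
        conj (d s) * c s + d s * conj (c s) = 0 := fun s =>
      orthogonal_of_norm_eq_one (by simpa using h s ∅)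
        (by simpa [hneg] using h s {⟨0, by omega⟩})
    simp only [hneg]
    fin_cases s
    · exact hasNormalForm_of_opposite_signs_of_ne_zero hds hcs hdc (fun s => (horth s).1)
        fun s => (horth s).2
    · refine (permLUEquivalent_reducedOp_flip d c _).hasNormalForm
        (hasNormalForm_of_opposite_signs_of_ne_zero hds hcs hdc.symm ?_ ?_)
      · intro s
        fin_cases s
        · exact (horth 1).1
        · exact (horth 0).1
      · intro s
        fin_cases s
        · exact (horth 1).2
        · exact (horth 0).2
  · push Not at hs
    have hzero : ∀ s, d s = 0 → (‖c s‖ = 1 ∧ ∀ j, ‖w j‖ = 1) := by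
      intro s hds
      have e := h s
      rw [hds] at e
      have e0 : ‖c s‖ = 1 := by simpa using e ∅
      refine ⟨e0, fun j => ?_⟩
      simpa [e0] using e {j}
    have hone : ∀ s, c s = 0 → ‖d s‖ = 1 := fun s hcs => by simpa [hcs] using h s ∅
    by_cases hd0 : d 0 = 0
    · have hd1 : d 1 ≠ 0 := fun h0 => hdc (by rw [hd0, h0, zero_mul, zero_mul])
      have hc1 := hs 1 hd1
      exact (permLUEquivalent_reducedOp_flip d c _).hasNormalForm
        (hasNormalForm_of_controlled hw (hzero 0 hd0).2 (hone 1 hc1) hd0 hc1 (hzero 0 hd0).1)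
    · have hc0 := hs 0 hd0
      have hd1 : d 1 = 0 := by
        by_contra h1
        exact hdc (by rw [hs 1 h1, hc0, mul_zero, mul_zero])
      exact hasNormalForm_of_controlled hw (hzero 1 hd1).2 (hone 0 hc0) hd1 hc0 (hzero 1 hd1).1

theorem hasNormalForm_of_projections {c : Fin 2 → ℂ} (hc : c 0 ≠ c 1) (h : ∀ s, ‖1 + c s‖ = 1) :
    HasNormalForm (reducedOp ![1, 1] c fun _ : Fin m => ![1, 0]) := by
  have hexp : ∀ s, c s ≠ 0 → ∃ θ ∈ Set.Ioo 0 (2 * Real.pi),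
      Complex.exp (Complex.I * θ) = 1 + c s := fun s hs =>
    exists_exp_eq_of_norm_eq_one (h s) (by simpa using hs)
  have hall : ∀ z : ℂ, z ≠ 0 → ‖1 + z‖ = 1 →
      HasNormalForm (reducedOp ![1, 1] ![z, 0] fun _ : Fin m => ![1, 0]) := by
    intro z hz hn
    obtain ⟨θ, hθ, hθz⟩ := exists_exp_eq_of_norm_eq_one hn (by simpa using hz)
    refine Or.inl ⟨θ, hθ, ?_⟩
    rw [formAll_eq, hθz, add_sub_cancel_left]
    exact PermLUEquivalent.refl _
  by_cases h1 : c 1 = 0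
  · have : c = ![c 0, 0] := by ext s; fin_cases s <;> simp [h1]
    rw [this]
    exact hall _ (fun h0 => hc (by rw [h0, h1])) (h 0)
  by_cases h0 : c 0 = 0
  · refine (permLUEquivalent_reducedOp_flip _ c _).hasNormalForm ?_
    rw [h0]
    exact hall _ h1 (h 1)
  obtain ⟨θ, hθ, hθc⟩ := hexp 0 h0
  obtain ⟨φ, hφ, hφc⟩ := hexp 1 h1
  refine Or.inr (Or.inl ⟨θ, hθ, φ, hφ, fun he => hc ?_, ?_⟩)
  · rw [he, hφc] at hθc
    exact (add_left_cancel hθc).symm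
  · refine PermLUEquivalent.symm ?_
    convert permLUEquivalent_formAllButOne θ φ using 2
    ext s
    fin_cases s <;> simp [hθc, hφc]

/-- The nonzero entries `e j.succ 0` are absorbed into the first qubit, leaving `![1, 0]` at every
other site. -/
theorem hasNormalForm_one_add_prod_of_forall_succ {e : Fin (m + 1) → Fin 2 → ℂ}
    (he : e 0 0 ≠ e 0 1) (he0 : ∀ j : Fin m, e j.succ 0 ≠ 0) (he1 : ∀ j : Fin m, e j.succ 1 = 0)
    (h : ∀ x : Fin (m + 1) → Fin 2, ‖1 + ∏ i, e i (x i)‖ = 1) :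
    HasNormalForm (Matrix.diagonal fun x => 1 + ∏ i, e i (x i)) := by
  set E : ℂ := ∏ j : Fin m, e j.succ 0 with hE
  have hE0 : E ≠ 0 := Finset.prod_ne_zero_iff.2 fun j _ => he0 j
  have heq : (Matrix.diagonal fun x => 1 + ∏ i, e i (x i)) =
      reducedOp ![1, 1] (fun s => e 0 s * E) fun _ : Fin m => ![1, 0] := by
    rw [reducedOp]
    congr 1
    ext1 x
    have h1 : ∏ j : Fin m, e j.succ (x j.succ) =
        E * ∏ j : Fin m, (![1, 0] : Fin 2 → ℂ) (x j.succ) := by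
      rw [hE, ← Finset.prod_mul_distrib]
      refine Finset.prod_congr rfl fun j _ => ?_
      generalize x j.succ = s
      fin_cases s <;> simp [he1]
    have h2 : (![1, 1] : Fin 2 → ℂ) (x 0) = 1 := by
      generalize x 0 = s
      fin_cases s <;> rfl
    rw [Fin.prod_univ_succ, h1, h2, mul_assoc]
  rw [heq]
  refine hasNormalForm_of_projections (fun h0 => he (mul_right_cancel₀ hE0 h0)) fun s => ?_
  have := h (Fin.cons s fun _ => 0)
  rwa [Fin.prod_univ_succ] at this

/-- Two distinct such sites, with a nonzero entry frozen at every other site, would give the rank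
one array excluded by `not_norm_one_add_eq_one`. -/
theorem eq_of_forall_ne_zero {n : ℕ} {e : Fin n → Fin 2 → ℂ} (he : ∀ i, e i 0 ≠ e i 1)
    (h : ∀ x : Fin n → Fin 2, ‖1 + ∏ i, e i (x i)‖ = 1) {i k : Fin n} (hi : ∀ s, e i s ≠ 0)
    (hk : ∀ s, e k s ≠ 0) : i = k := by
  by_contra hik
  have hg : ∀ l, ∃ s, e l s ≠ 0 := by
    intro l
    by_contra! h0
    exact he l (by rw [h0, h0])
  choose g hg using hg
  set R := ∏ l ∈ (Finset.univ.erase i).erase k, e l (g l) with hR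
  have hR0 : R ≠ 0 := Finset.prod_ne_zero_iff.2 fun l _ => hg l
  have key : ∀ s t, ‖1 + e i s * (e k t * R)‖ = 1 := by
    intro s t
    have hrest : ∏ l ∈ (Finset.univ.erase i).erase k,
        e l (Function.update (Function.update g i s) k t l) = R := by
      refine Finset.prod_congr rfl fun l hl => ?_
      rw [Function.update_of_ne (Finset.ne_of_mem_erase hl),
        Function.update_of_ne (Finset.ne_of_mem_erase (Finset.mem_of_mem_erase hl))]
    rw [← h (Function.update (Function.update g i s) k t),
      ← Finset.mul_prod_erase Finset.univ _ (Finset.mem_univ i),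
      ← Finset.mul_prod_erase (Finset.univ.erase i) _
        (Finset.mem_erase.2 ⟨Ne.symm hik, Finset.mem_univ k⟩), hrest, Function.update_self,
      Function.update_of_ne hik, Function.update_self]
  have h0 := hi 0
  have h1 := hk 0
  refine not_norm_one_add_eq_one (z := e i 0 * (e k 0 * R)) (r := e i 1 / e i 0)
    (t := e k 1 / e k 0) (mul_ne_zero h0 (mul_ne_zero h1 hR0)) (div_ne_zero (hi 1) h0)
    (div_ne_zero (hk 1) h1) (fun h2 => he i ((div_eq_one_iff_eq h0).1 h2).symm)
    (fun h2 => he k ((div_eq_one_iff_eq h1).1 h2).symm) (key 0 0) ?_ ?_ ?_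
  · rw [← key 1 0]
    congr 2
    field_simp
  · rw [← key 0 1]
    congr 2
    field_simp
  · rw [← key 1 1]
    congr 2
    field_simp

theorem hasNormalForm_one_add_prod {e : Fin (m + 1) → Fin 2 → ℂ} (he : ∀ i, e i 0 ≠ e i 1)
    (h : ∀ x : Fin (m + 1) → Fin 2, ‖1 + ∏ i, e i (x i)‖ = 1) :
    HasNormalForm (Matrix.diagonal fun x => 1 + ∏ i, e i (x i)) := by
  obtain ⟨k, hk⟩ : ∃ k, ∀ i, i ≠ k → ∃ s, e i s = 0 := by
    by_cases hex : ∃ k, ∀ s, e k s ≠ 0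
    · obtain ⟨k, hk⟩ := hex
      refine ⟨k, fun i hik => ?_⟩
      by_contra! h0
      exact hik (eq_of_forall_ne_zero he h h0 hk)
    · push Not at hex
      exact ⟨0, fun i _ => hex i⟩
  have hτ : ∀ i, i ≠ k → ∃ τ : Equiv.Perm (Fin 2), e i (τ 0) ≠ 0 ∧ e i (τ 1) = 0 := by
    intro i hi
    obtain ⟨s, hs⟩ := hk i hi
    fin_cases s
    · exact ⟨Equiv.swap 0 1, fun h1 => he i (hs.trans (by simpa using h1.symm)), by simpa using hs⟩
    · exact ⟨1, fun h1 => he i (Eq.trans h1 hs.symm), hs⟩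
  -- The one site that may lack a zero entry is moved to position 0; at the others a flip puts the
  -- zero at bit 1.
  set σ := Equiv.swap 0 k with hσ
  have hσ' : ∀ j : Fin m, σ j.succ ≠ k := fun j h0 => Fin.succ_ne_zero j
    (σ.injective (by rw [h0, hσ, Equiv.swap_apply_left]))
  choose τ hτ0 hτ1 using fun j : Fin m => hτ _ (hσ' j)
  set e' : Fin (m + 1) → Fin 2 → ℂ := fun i s =>
    e (σ i) ((Fin.cons 1 τ : Fin (m + 1) → Equiv.Perm (Fin 2)) i s) with he'
  have hequiv : PermLUEquivalent (Matrix.diagonal fun x => 1 + ∏ i, e i (x i))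
      (Matrix.diagonal fun x => 1 + ∏ i, e' i (x i)) := by
    refine (permLUEquivalent_diagonal_perm σ _).trans ?_
    convert permLUEquivalent_diagonal_flip (Fin.cons 1 τ : Fin (m + 1) → Equiv.Perm (Fin 2)) _
      using 3 with x
    congr 1
    rw [← Equiv.prod_comp σ]
    simp [he', hσ]
  have hnorm : ∀ x : Fin (m + 1) → Fin 2, ‖1 + ∏ i, e' i (x i)‖ = 1 :=
    (diagonal_mem_unitaryGroup_iff _).1
      (hequiv.mem_unitaryGroup ((diagonal_mem_unitaryGroup_iff _).2 h))
  refine hequiv.hasNormalForm (hasNormalForm_one_add_prod_of_forall_succ ?_ ?_ ?_ hnorm)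
  · exact he _
  · intro j
    simpa [he'] using hτ0 j
  · intro j
    simpa [he'] using hτ1 j

theorem hasNormalForm_reducedOp (hm : 3 ≤ m) {d c : Fin 2 → ℂ} {w : Fin m → ℂ}
    (hdc : d 0 * c 1 ≠ d 1 * c 0) (hw : ∀ j, w j ≠ 1)
    (hunit : reducedOp d c (fun j => ![1, w j]) ∈ Matrix.unitaryGroup (Fin (m + 1) → Fin 2) ℂ) :
    HasNormalForm (reducedOp d c fun j => ![1, w j]) := by
  have hn := (diagonal_mem_unitaryGroup_iff _).1 hunit
  have h : ∀ s (S : Finset (Fin m)), ‖d s + c s * ∏ j ∈ S, w j‖ = 1 := by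
    intro s S
    rw [← hn (Fin.cons s fun j => if j ∈ S then 1 else 0)]
    simp only [Fin.cons_zero, Fin.cons_succ]
    congr 3
    rw [← Finset.prod_ite_mem_eq]
    refine Finset.prod_congr rfl fun j _ => ?_
    split_ifs <;> rfl
  by_cases hw0 : ∀ j, w j ≠ 0
  · exact hasNormalForm_of_ne_zero hm hdc hw hw0 h
  push Not at hw0
  obtain ⟨j, hj⟩ := hw0
  -- A vanishing `w j` switches off the second term, so `d` is a phase and can be normalised to 1.
  have hd : ∀ s, ‖d s‖ = 1 := fun s => by simpa [hj] using h s {j}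
  have hd0 : ∀ s, d s ≠ 0 := fun s => norm_ne_zero_iff.1 (by rw [hd]; exact one_ne_zero)
  have hph := permLUEquivalent_reducedOp_phase (φ := fun s => (d s)⁻¹)
    (fun s => by rw [norm_inv, hd, inv_one]) d c fun j => ![1, w j]
  have heq : reducedOp (fun s => (d s)⁻¹ * d s) (fun s => (d s)⁻¹ * c s) (fun j => ![1, w j]) =
      Matrix.diagonal fun x => 1 + ∏ i, (Fin.cons (fun s => (d s)⁻¹ * c s) fun j => ![1, w j] :
        Fin (m + 1) → Fin 2 → ℂ) i (x i) := by
    rw [reducedOp]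
    congr 1
    ext1 x
    rw [Fin.prod_univ_succ]
    simp only [Fin.cons_zero, Fin.cons_succ]
    rw [inv_mul_cancel₀ (hd0 _)]
  refine hph.hasNormalForm ?_
  have hunit' := hph.mem_unitaryGroup hunit
  rw [heq] at hunit' ⊢
  refine hasNormalForm_one_add_prod (fun i => ?_) ((diagonal_mem_unitaryGroup_iff _).1 hunit')
  refine Fin.cases ?_ (fun j => ?_) i
  · simp only [Fin.cons_zero]
    intro h0
    rw [inv_mul_eq_iff_eq_mul₀ (hd0 0)] at h0
    refine hdc ?_
    rw [h0]
    have := hd0 1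
    field_simp
  · simpa using (hw j).symm

theorem IsGenuineSR2Gate.hasNormalForm_prodOp_add (hm : 3 ≤ m) {A B : Fin (m + 1) → QubitOp}
    (h : IsGenuineSR2Gate (prodOp A + prodOp B)) : HasNormalForm (prodOp A + prodOp B) := by
  obtain ⟨a, b, hab, hnorm, hdiag⟩ := h.exists_diagonal (by omega)
  obtain ⟨d, c, w, hdc, hw, hred⟩ := exists_reducedOp hm hab hnorm
  have hequiv := hdiag.trans hred
  exact hequiv.hasNormalForm (hasNormalForm_reducedOp hm hdc hw (hequiv.mem_unitaryGroup h.unitary))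

end NormalForms

/-! ### Existence and uniqueness of the singular number, and the classification. -/

section Classification

theorem IsGenuineSR2Gate.exists_hasSingularNumber {n : ℕ} {U : NQubitOp n}
    (h : IsGenuineSR2Gate U) : ∃ k, HasSingularNumber U k := by
  have h2 := h.schmidtRank_eq
  -- The infimum of the empty set of naturals is 0, so rank two already implies that decompositions
  -- exist.
  have hne : {r : ℕ | ∃ A : Fin r → Fin n → QubitOp, U = ∑ j, prodOp (A j)}.Nonempty :=
    Nat.nonempty_of_pos_sInf (by
      change 0 < schmidtRank U
      omega)
  have hmem := Nat.sInf_mem hne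
  change schmidtRank U ∈ _ at hmem
  rw [h2] at hmem
  obtain ⟨A, hA⟩ := hmem
  exact ⟨_, A, ⟨h2, hA⟩, rfl⟩

theorem IsGenuineSR2Gate.hasSingularNumber_unique {n : ℕ} (hn : 3 ≤ n) {U : NQubitOp n}
    (h : IsGenuineSR2Gate U) {k l : ℕ} (hk : HasSingularNumber U k) (hl : HasSingularNumber U l) :
    k = l := by
  obtain ⟨A, ⟨-, hA⟩, rfl⟩ := hk
  obtain ⟨C, ⟨-, hC⟩, rfl⟩ := hl
  rw [Fin.sum_univ_two] at hA hC
  refine singularCount_eq_of_sum_prodOp_eq hn (hA.symm.trans hC) ?_ ?_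
  · exact (hA ▸ h).linearIndependent (by omega)
  · exact (hC ▸ h).linearIndependent (by omega)

theorem IsGenuineSR2Gate.hasNormalForm {m : ℕ} (hm : 3 ≤ m) {U : NQubitOp (m + 1)}
    (h : IsGenuineSR2Gate U) : HasNormalForm U := by
  obtain ⟨k, A, ⟨-, hA⟩, -⟩ := h.exists_hasSingularNumber
  rw [Fin.sum_univ_two] at hA
  subst hA
  exact h.hasNormalForm_prodOp_add hm

end Classification

theorem theorem3 (n : ℕ) (hn : 4 ≤ n) :
    -- the singular number is well defined and lies in {0, 1, 2, n - 1, n}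
    (∀ U : NQubitOp n, IsGenuineSR2Gate U →
      (∃! k : ℕ, HasSingularNumber U k) ∧
        ∀ k : ℕ, HasSingularNumber U k → k = 0 ∨ k = 1 ∨ k = 2 ∨ k = n - 1 ∨ k = n) ∧
    -- k = n
    (∀ U : NQubitOp n, U ∈ genuineSR2Class n n ↔
      ∃ θ ∈ Set.Ioo 0 (2 * Real.pi), PermLUEquivalent U (formAll n θ)) ∧
    -- k = n - 1
    (∀ U : NQubitOp n, U ∈ genuineSR2Class n (n - 1) ↔
      ∃ θ ∈ Set.Ioo 0 (2 * Real.pi), ∃ φ ∈ Set.Ioo 0 (2 * Real.pi), θ ≠ φ ∧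
        PermLUEquivalent U (formAllButOne n θ φ)) ∧
    -- k = 2
    (∀ U : NQubitOp n, U ∈ genuineSR2Class n 2 ↔
      ∃ β : Fin n → ℝ, (∀ i : Fin n, (i : ℕ) ≠ 0 → β i ∈ Set.Ioo 0 (2 * Real.pi)) ∧
        PermLUEquivalent U (formTwo n β)) ∧
    -- k = 1
    (∀ U : NQubitOp n, U ∈ genuineSR2Class n 1 ↔
      ∃ α ∈ Set.Ioo 0 (Real.pi / 2) ∪ Set.Ioo (Real.pi / 2) Real.pi,
        PermLUEquivalent U (formOne n α)) ∧
    -- k = 0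
    (∀ U : NQubitOp n, U ∈ genuineSR2Class n 0 ↔
      ∃ α ∈ nonQuarterAngles, ∃ β ∈ nonQuarterAngles, Real.sin (α - β) ≠ 0 ∧
        PermLUEquivalent U (formZero n α β)) := by
  obtain ⟨m, rfl⟩ : ∃ m, n = m + 1 := ⟨n - 1, by omega⟩
  have hm : 3 ≤ m := by omega
  have hm1 : 1 ≤ m := by omega
  rw [Nat.add_sub_cancel]
  -- a gate with singular number `k` has a normal form, whose singular number is again `k`
  have key : ∀ (U : NQubitOp (m + 1)) (k : ℕ), U ∈ genuineSR2Class (m + 1) k →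
      (k = m + 1 ∧ ∃ θ ∈ Set.Ioo 0 (2 * Real.pi), PermLUEquivalent U (formAll (m + 1) θ)) ∨
      (k = m ∧ ∃ θ ∈ Set.Ioo 0 (2 * Real.pi), ∃ φ ∈ Set.Ioo 0 (2 * Real.pi), θ ≠ φ ∧
        PermLUEquivalent U (formAllButOne (m + 1) θ φ)) ∨
      (k = 2 ∧ ∃ β : Fin (m + 1) → ℝ,
        (∀ i : Fin (m + 1), (i : ℕ) ≠ 0 → β i ∈ Set.Ioo 0 (2 * Real.pi)) ∧
          PermLUEquivalent U (formTwo (m + 1) β)) ∨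
      (k = 1 ∧ ∃ α ∈ Set.Ioo 0 (Real.pi / 2) ∪ Set.Ioo (Real.pi / 2) Real.pi,
        PermLUEquivalent U (formOne (m + 1) α)) ∨
      (k = 0 ∧ ∃ α ∈ nonQuarterAngles, ∃ β ∈ nonQuarterAngles, Real.sin (α - β) ≠ 0 ∧
        PermLUEquivalent U (formZero (m + 1) α β)) := by
    rintro U k ⟨hU, hk⟩
    have huniq : ∀ {l}, U ∈ genuineSR2Class (m + 1) l → k = l := fun hl =>
      hU.hasSingularNumber_unique (by omega) hk hl.2
    rcases hU.hasNormalForm hm with h | h | h | h | h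
    · refine Or.inl ⟨huniq ?_, h⟩
      obtain ⟨θ, hθ, h⟩ := h
      exact mem_class_of_formAll hm1 hθ h
    · refine Or.inr (Or.inl ⟨huniq ?_, h⟩)
      obtain ⟨θ, hθ, φ, hφ, hne, h⟩ := h
      exact mem_class_of_formAllButOne hm1 hθ hφ hne h
    · refine Or.inr (Or.inr (Or.inl ⟨huniq ?_, h⟩))
      obtain ⟨β, hβ, h⟩ := h
      exact mem_class_of_formTwo hm1 hβ h
    · refine Or.inr (Or.inr (Or.inr (Or.inl ⟨huniq ?_, h⟩)))
      obtain ⟨α, hα, h⟩ := h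
      exact mem_class_of_formOne hm1 hα h
    · refine Or.inr (Or.inr (Or.inr (Or.inr ⟨huniq ?_, h⟩)))
      obtain ⟨α, hα, β, hβ, hne, h⟩ := h
      exact mem_class_of_formZero hm1 hα hβ hne h
  refine ⟨fun U hU => ⟨?_, fun k hk => ?_⟩, fun U => ⟨fun hU => ?_, ?_⟩, fun U => ⟨fun hU => ?_, ?_⟩,
    fun U => ⟨fun hU => ?_, ?_⟩, fun U => ⟨fun hU => ?_, ?_⟩, fun U => ⟨fun hU => ?_, ?_⟩⟩
  · obtain ⟨k, hk⟩ := hU.exists_hasSingularNumber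
    exact ⟨k, hk, fun l hl => hU.hasSingularNumber_unique (by omega) hl hk⟩
  · rcases key U k ⟨hU, hk⟩ with h | h | h | h | h <;> omega
  -- The values `m + 1, m, 2, 1, 0` are pairwise distinct because `3 ≤ m`, so only the family of the
  -- given singular number survives.
  · rcases key U _ hU with h | h | h | h | h <;> first | exact h.2 | omega
  · rintro ⟨θ, hθ, h⟩
    exact mem_class_of_formAll hm1 hθ h
  · rcases key U _ hU with h | h | h | h | h <;> first | exact h.2 | omega
  · rintro ⟨θ, hθ, φ, hφ, hne, h⟩
    exact mem_class_of_formAllButOne hm1 hθ hφ hne h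
  · rcases key U _ hU with h | h | h | h | h <;> first | exact h.2 | omega
  · rintro ⟨β, hβ, h⟩
    exact mem_class_of_formTwo hm1 hβ h
  · rcases key U _ hU with h | h | h | h | h <;> first | exact h.2 | omega
  · rintro ⟨α, hα, h⟩
    exact mem_class_of_formOne hm1 hα h
  · rcases key U _ hU with h | h | h | h | h <;> first | exact h.2 | omega
  · rintro ⟨α, hα, β, hβ, hne, h⟩
    exact mem_class_of_formZero hm1 hα hβ hne h
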